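/- Let $E$ be a Lusin topological space (a homeomorph of a Borel subset of a compact metric space) with its Borel $\sigma$-algebra. Let $M(E)^\circ$ be the space of nonzero finite Borel measures on $E$ and $M_0(E)$ the space of Borel probability measures on $E$, both with the weak topology and its Borel $\sigma$-algebra. Let $B^+(E)$ be the set of bounded nonnegative Borel functions on $E$ and $B_a^+(E)=\{f\in B^+(E):\|f\|\le a\}$, where $\|\cdot\|$ is the supremum norm; write $\nu(f)=\int_E f\,d\nu$. A kernel is called bounded if its total masses are bounded by a finite constant. For a probability kernel $G(x,d\pi)$ from $E$ to $M_0(E)$ and, for each $k\ge1$ and $(x,\pi)\in E\times M_0(E)$, a probability distribution $(q^{(k)}_i(x,\pi))_{i\ge0}$ whose generating function $h_k(x,\pi,z)=\sum_{i\ge0}q^{(k)}_i(x,\pi)z^i$ is measurable on $E\times M_0(E)\times[0,1]$ and satisfies $\sup_{x,\pi}\frac{d}{dz}h_k(x,\pi,1^-)<\infty$, put $$\zeta_k(x,f)=\int_{M_0(E)}k\big[1-h_k(x,\pi,1-\pi(f)/k)\big]\,G(x,d\pi)\qquad(f\in B_k^+(E)).\tag{A}$$ (i) Suppose that $\sum_{i}i\,q_i^{(k)}(x,\pi)\le1$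 for all $k,x,\pi$, and that for each $a\ge0$, $\zeta_k\to\zeta$ uniformly on $E\times B_a^+(E)$ as $k\to\infty$. Then for $x\in E$, $f\in B^+(E)$, $$\zeta(x,f)=\lambda(x,f)+\int_{M(E)^\circ}(1-e^{-\nu(f)})\,\Gamma(x,d\nu),\tag{B}$$ where $\lambda(x,dy)$ is a bounded kernel on $E$, $\nu(1)\Gamma(x,d\nu)$ is a bounded kernel from $E$ to $M(E)^\circ$, and for all $x\in E$ $$\lambda(x,1)+\int_{M(E)^\circ}\nu(1)\,\Gamma(x,d\nu)\le1.$$ (ii) A functional $\zeta(x,f)$ on $E\times B^+(E)$ has a representation (B) with $\lambda,\Gamma$ as in (i) if and only if $$\zeta(x,f)=\int_{M_0(E)}\Big[d(x,\pi)\,\pi(f)+\int_0^\infty(1-e^{-u\pi(f)})\,n(x,\pi,du)\Big]G(x,d\pi)\tag{C}$$ for some probability kernel $G(x,d\pi)$ from $E$ to $M_0(E)$, some bounded nonnegative measurable $d$ on $E\times M_0(E)$ and some $n$ such that $u\,n(x,\pi,du)$ is a bounded kernel from $E\times M_0(E)$ to $(0,\infty)$, with $d(x,\pi)+\int_0^\infty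 u\,n(x,\pi,du)\le1$ for all $(x,\pi)$. (iii) For every $\zeta$ given by (C), with $G,d,n$ as in (ii), there are offspring distributions $q^{(k)}_i(x,\pi)$, $k\ge1$, as above with $\sum_i i\,q^{(k)}_i(x,\pi)\le1$ such that the functionals $\zeta_k$ of the form (A), with the same kernel $G$, converge to $\zeta$ uniformly on $E\times B_a^+(E)$ for each $a\ge0$. -/

import Mathlib

open MeasureTheory ProbabilityTheory Filter Set Topology
open scoped NNReal ENNReal

namespace NonlocalBranching

/-- A Lusin topological space: a homeomorph of a Borel subset of some compact metric space. -/
def IsLusin.{u} (E : Type u) [TopologicalSpace E] : Prop :=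
  ∃ (K : Type u) (_ : MetricSpace K) (_ : CompactSpace K) (e : E → K),
    IsEmbedding e ∧ @MeasurableSet K (borel K) (range e)

section

variable (E : Type*) [MeasurableSpace E]

/-- `B⁺(E)`: the bounded nonnegative measurable functions on `E`. -/
def BPlus : Set (E → ℝ) :=
  {f | Measurable f ∧ (∀ x, 0 ≤ f x) ∧ ∃ C : ℝ, ∀ x, f x ≤ C}

/-- `B⁺ₐ(E)`: the nonnegative measurable functions with supremum norm at most `a`. -/
def BPlusLE (a : ℝ) : Set (E → ℝ) :=
  {f | Measurable f ∧ (∀ x, 0 ≤ f x) ∧ ∀ x, f x ≤ a}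

/-- `M(E)°`: the nonzero finite measures on `E`. The σ-algebra (inherited from Mathlib's
`FiniteMeasure E`) is generated by the evaluations `ν ↦ ν(B)`; for a Lusin space `E` with its Borel
σ-algebra it is the Borel σ-algebra of the weak topology. The same holds for
`ProbabilityMeasure E`, the space `M₀(E)`. -/
abbrev NonzeroFiniteMeasure : Type _ := {ν : FiniteMeasure E // ν ≠ 0}

/-- `(0, ∞)`, with its Borel σ-algebra. -/
abbrev PosReal : Type := {u : ℝ // 0 < u}

end

/-- `κ(x, dy)` is a bounded kernel: `x ↦ κ(x, ·)` is measurable, and the total masses are bounded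
by a finite constant. -/
def IsBoundedKernel {α β : Type*} [MeasurableSpace α] [MeasurableSpace β]
    (κ : α → Measure β) : Prop :=
  Measurable κ ∧ ∃ C : ℝ≥0, ∀ x, κ x univ ≤ C

variable {E : Type*} [MeasurableSpace E]

/-- The probability generating function `h(x, π, z) = ∑ᵢ qᵢ(x, π) zⁱ`. -/
noncomputable def genFun (q : ℕ → E → ProbabilityMeasure E → ℝ)
    (x : E) (π : ProbabilityMeasure E) (z : ℝ) : ℝ :=
  ∑' i, q i x π * z ^ i

/-- The offspring mean `∑ᵢ i qᵢ(x, π)`, as an extended nonnegative number. For a probability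
distribution `qᵢ(x, π)` it is the left derivative at `z = 1` of the generating function. -/
noncomputable def offspringMean (q : ℕ → E → ProbabilityMeasure E → ℝ)
    (x : E) (π : ProbabilityMeasure E) : ℝ≥0∞ :=
  ∑' i : ℕ, (i : ℝ≥0∞) * ENNReal.ofReal (q i x π)

/-- `qᵢ(x, π)`, `i ≥ 0`, is a family of offspring distributions: each is a probability distribution
on `{0, 1, 2, …}`, the generating function is measurable on `E × M₀(E) × [0, 1]`, and its left
derivative at `z = 1` is bounded in `(x, π)`. -/
structure IsOffspringLaw (q : ℕ → E → ProbabilityMeasure E → ℝ) : Prop where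
  nonneg : ∀ i x π, 0 ≤ q i x π
  hasSum_one : ∀ x π, HasSum (fun i => q i x π) 1
  measurable_genFun :
    Measurable fun p : E × ProbabilityMeasure E × Icc (0 : ℝ) 1 => genFun q p.1 p.2.1 p.2.2
  mean_bounded : ∃ C : ℝ≥0, ∀ x π, offspringMean q x π ≤ C

/-- The particle form
`ζₖ(x, f) = ∫ k [1 - hₖ(x, π, 1 - π(f) / k)] G(x, dπ)` (meaningful for `k ≥ 1` and `f ≤ k`). -/
noncomputable def particleZeta (G : Kernel E (ProbabilityMeasure E))
    (q : ℕ → E → ProbabilityMeasure E → ℝ) (k : ℕ) (x : E) (f : E → ℝ) : ℝ :=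
  ∫ π, (k : ℝ) * (1 - genFun q x π (1 - (∫ y, f y ∂(π : Measure E)) / k)) ∂(G x)

/-- `(qᵢ⁽ᵏ⁾)`, `k ≥ 1`, is a sequence of families of offspring distributions with means at most one,
and the particle forms `ζₖ` converge to `ζ` uniformly on `E × B⁺ₐ(E)` for each `a ≥ 0`.
(For given `a` only the indices `k ≥ a` matter, and for these `1 - π(f) / k ∈ [0, 1]`.) -/
structure SubcriticalApprox (G : Kernel E (ProbabilityMeasure E))
    (q : ℕ → ℕ → E → ProbabilityMeasure E → ℝ) (ζ : E → (E → ℝ) → ℝ) : Prop where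
  law : ∀ k, 1 ≤ k → IsOffspringLaw (q k)
  mean_le_one : ∀ k, 1 ≤ k → ∀ x π, offspringMean (q k) x π ≤ 1
  tendsto : ∀ a : ℝ, 0 ≤ a →
    TendstoUniformlyOn (fun k (p : E × (E → ℝ)) => particleZeta G (q k) k p.1 p.2)
      (fun p => ζ p.1 p.2) atTop (univ ×ˢ BPlusLE E a)

/-- `ζ(x, f) = lam(x, f) + ∫ (1 - exp(-ν(f))) Γ(x, dν)` for `x ∈ E`, `f ∈ B⁺(E)`, where
`lam(x, dy)` and `ν(1) Γ(x, dν)` are bounded kernels with `lam(x, 1) + ∫ ν(1) Γ(x, dν) ≤ 1`. -/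
structure MeasureRep (lam : E → Measure E) (Γ : E → Measure (NonzeroFiniteMeasure E))
    (ζ : E → (E → ℝ) → ℝ) : Prop where
  kernel_lam : IsBoundedKernel lam
  kernel_Γ : IsBoundedKernel fun x => (Γ x).withDensity fun ν => (ν.1.mass : ℝ≥0∞)
  mass_le_one : ∀ x, lam x univ + ∫⁻ ν, (ν.1.mass : ℝ≥0∞) ∂(Γ x) ≤ 1
  rep : ∀ x, ∀ f ∈ BPlus E,
    ζ x f = (∫ y, f y ∂(lam x)) +
      ∫ ν, (1 - Real.exp (-∫ y, f y ∂(ν.1 : Measure E))) ∂(Γ x)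

/-- `ζ(x, f) = ∫ [d(x, π) π(f) + ∫ (1 - exp(-u π(f))) n(x, π, du)] G(x, dπ)` for `x ∈ E`,
`f ∈ B⁺(E)`, where `d` is bounded, nonnegative and measurable, `u n(x, π, du)` is a bounded kernel
to `(0, ∞)`, and `d(x, π) + ∫ u n(x, π, du) ≤ 1`. -/
structure MixtureRep (G : Kernel E (ProbabilityMeasure E))
    (d : E × ProbabilityMeasure E → ℝ) (n : E × ProbabilityMeasure E → Measure PosReal)
    (ζ : E → (E → ℝ) → ℝ) : Prop where
  d_measurable : Measurable d
  d_nonneg : ∀ p, 0 ≤ d p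
  d_bounded : ∃ C : ℝ, ∀ p, d p ≤ C
  kernel_n : IsBoundedKernel fun p => (n p).withDensity fun u => ENNReal.ofReal u.1
  mass_le_one : ∀ p, ENNReal.ofReal (d p) + ∫⁻ u, ENNReal.ofReal u.1 ∂(n p) ≤ 1
  rep : ∀ x, ∀ f ∈ BPlus E,
    ζ x f = ∫ π, (d (x, π) * (∫ y, f y ∂(π : Measure E)) +
      ∫ u, (1 - Real.exp (-(u.1 * ∫ y, f y ∂(π : Measure E)))) ∂(n (x, π))) ∂(G x)

end NonlocalBranching

open NonlocalBranching

/-! The function `(1 - exp(-u s)) / u` extends continuously to `u` in the compact half-line `[0,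
∞]`, with value `s` at `u = 0` and `0` at `u = ∞`. After size-biasing, each of the forms (B) and (C)
is an integral of this function at `s = π(f)` against a probability measure on `M₀(E) × [0, ∞]`: the
point `u = 0` carries the linear term, `u ∈ (0, ∞)` carries the jumps, and the mass missing from one
is put at `u = ∞`, where no functional sees it (`laplaceQuotient`, `integral_laplaceQuotient_eq`).

For (i), giving `i` particles of mass `1 / k` the coordinate `u = i / k` and the weight `i qᵢ` turns
(A) into the same kind of integral, up to an error `s² / k` (`exists_kernel_sizeBiased`). For fixed
`x` the size-biased kernels from `M₀(E)` to `[0, ∞]` have a limit kernel in the sense of Young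
measures relative to `G(x, ·)` (`exists_kernel_of_tendsto`), and `exists_measures_of_joint` reads
`lam` and `Γ` off the joint law. These are chosen separately for each `x`; they are measurable in
`x` because the measurable functionals `ζ(·, f)` determine them (`MeasureRep.of_measurable`).

For (iii), Poissonisation is exact: if a jump `u` produces a Poisson(`u k`) number of particles of
mass `1 / k`, then `ζₖ = ζ` on `B⁺ₐ(E)` as soon as `k ≥ a` (`MixtureRep.particle_eq`). For (ii), a
mixture is of the form (B) by (iii) followed by (i); conversely, polar coordinates `ν = ν(1) · ν /
ν(1)` send (B) to a joint law on `M₀(E) × [0, ∞]`, whose disintegration over `M₀(E)` gives `G`, `d`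
and `n` (`MeasureRep.exists_mixtureRep`). -/

namespace NonlocalBranching

/-! ### Functional monotone class argument for multiplicative classes. -/

/-- The linear span of a set of functions, closed under bounded pointwise sequential limits. -/
inductive BoundedClosure {α : Type*} (C : Set (α → ℝ)) : (α → ℝ) → Prop
  | basic {f : α → ℝ} (hf : f ∈ C) : BoundedClosure C f
  | add {f g : α → ℝ} (hf : BoundedClosure C f) (hg : BoundedClosure C g) :
      BoundedClosure C (fun x => f x + g x)
  | smul (c : ℝ) {f : α → ℝ} (hf : BoundedClosure C f) : BoundedClosure C (fun x => c * f x)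
  | lim (M : ℝ) {f : ℕ → α → ℝ} {g : α → ℝ} (hf : ∀ n, BoundedClosure C (f n))
      (hM : ∀ n x, |f n x| ≤ M) (hg : ∀ x, Tendsto (fun n => f n x) atTop (𝓝 (g x))) :
      BoundedClosure C g

namespace BoundedClosure

variable {α : Type*} {C : Set (α → ℝ)}

theorem bounded (hC : ∀ f ∈ C, ∃ M : ℝ, ∀ x, |f x| ≤ M) {f : α → ℝ} (hf : BoundedClosure C f) :
    ∃ M : ℝ, ∀ x, |f x| ≤ M := by
  induction hf with
  | basic hf => exact hC _ hf
  | add _ _ ih₁ ih₂ =>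
    obtain ⟨M, hM⟩ := ih₁
    obtain ⟨N, hN⟩ := ih₂
    exact ⟨M + N, fun x => (abs_add_le _ _).trans (add_le_add (hM x) (hN x))⟩
  | smul c _ ih =>
    obtain ⟨M, hM⟩ := ih
    exact ⟨|c| * M, fun x => by rw [abs_mul]; gcongr; exact hM x⟩
  | lim M _ hM hg _ =>
    exact ⟨M, fun x => le_of_tendsto (hg x).abs (Eventually.of_forall fun n => hM n x)⟩

/-- Induction on one factor at a time: the case of a basic `f` is settled against every `g` before
`f` is generalised. The factor held fixed is bounded, which supplies the uniform bound required for
limits. -/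
theorem mul (hC : ∀ f ∈ C, ∃ M : ℝ, ∀ x, |f x| ≤ M)
    (hmul : ∀ f ∈ C, ∀ g ∈ C, (fun x => f x * g x) ∈ C) {f g : α → ℝ}
    (hf : BoundedClosure C f) (hg : BoundedClosure C g) :
    BoundedClosure C (fun x => f x * g x) := by
  induction hf with
  | @basic f hf =>
    induction hg with
    | basic hg => exact .basic (hmul _ hf _ hg)
    | add _ _ ih₁ ih₂ => simpa only [mul_add] using ih₁.add ih₂
    | smul c _ ih => simpa only [mul_left_comm] using ih.smul c
    | lim M _ hM hg ih =>
      obtain ⟨N, hN⟩ := hC f hf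
      refine .lim (N * M) ih (fun n x => ?_) fun x => (hg x).const_mul _
      rw [abs_mul]
      exact mul_le_mul (hN x) (hM n x) (abs_nonneg _) ((abs_nonneg _).trans (hN x))
  | add _ _ ih₁ ih₂ => simpa only [add_mul] using ih₁.add ih₂
  | smul c _ ih => simpa only [mul_assoc] using ih.smul c
  | lim M _ hM hf ih =>
    obtain ⟨N, hN⟩ := hg.bounded hC
    refine .lim (M * N) ih (fun n x => ?_) fun x => (hf x).mul_const _
    rw [abs_mul]
    exact mul_le_mul (hM n x) (hN x) (abs_nonneg _) ((abs_nonneg _).trans (hM n x))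

theorem polynomial_eval (hone : (fun _ => 1) ∈ C) (hC : ∀ f ∈ C, ∃ M : ℝ, ∀ x, |f x| ≤ M)
    (hmul : ∀ f ∈ C, ∀ g ∈ C, (fun x => f x * g x) ∈ C) {f : α → ℝ}
    (hf : BoundedClosure C f) (p : Polynomial ℝ) : BoundedClosure C (fun x => p.eval (f x)) := by
  have hc : ∀ c : ℝ, BoundedClosure C (fun _ => c) := fun c => by
    simpa using (BoundedClosure.basic hone).smul c
  induction p using Polynomial.induction_on with
  | C a => simpa using hc a
  | add p q hp hq => simpa using hp.add hq
  | monomial n a h =>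
    simpa [pow_succ, mul_assoc] using h.mul hC hmul hf

/-- `f` takes values in a compact interval, on which Weierstrass approximates `φ` uniformly by
polynomials; these stay in the closure because it is an algebra. -/
theorem comp_continuous (hone : (fun _ => 1) ∈ C) (hC : ∀ f ∈ C, ∃ M : ℝ, ∀ x, |f x| ≤ M)
    (hmul : ∀ f ∈ C, ∀ g ∈ C, (fun x => f x * g x) ∈ C) {f : α → ℝ}
    (hf : BoundedClosure C f) {φ : ℝ → ℝ} (hφ : Continuous φ) :
    BoundedClosure C (fun x => φ (f x)) := by
  obtain ⟨M, hM⟩ := hf.bounded hC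
  have hmem : ∀ x, f x ∈ Icc (-M) M := fun x => abs_le.1 (hM x)
  choose p hp using fun n : ℕ => exists_polynomial_near_of_continuousOn (-M) M φ hφ.continuousOn
    (1 / ((n : ℝ) + 1)) (by positivity)
  obtain ⟨K, hK⟩ := (isCompact_Icc (a := -M) (b := M)).exists_bound_of_continuousOn hφ.continuousOn
  refine .lim (K + 1) (fun n => hf.polynomial_eval hone hC hmul (p n)) (fun n x => ?_) fun x => ?_
  · have h1 := (hp n _ (hmem x)).le
    have h2 : 1 / ((n : ℝ) + 1) ≤ 1 := by
      rw [div_le_one (by positivity)]; linarith [n.cast_nonneg (α := ℝ)]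
    have h3 := hK _ (hmem x)
    rw [Real.norm_eq_abs] at h3
    rw [abs_le] at *
    constructor <;> linarith [h1.1, h1.2, h3.1, h3.2]
  · rw [tendsto_iff_dist_tendsto_zero]
    refine squeeze_zero (fun _ => dist_nonneg) (fun n => ?_) tendsto_one_div_add_atTop_nhds_zero_nat
    rw [Real.dist_eq]
    exact (hp n _ (hmem x)).le

/-- The continuous ramps `min 1 (max 0 (n (y - t)))` tend pointwise to the indicator of `y > t`. -/
theorem indicator_lt (hone : (fun _ => 1) ∈ C) (hC : ∀ f ∈ C, ∃ M : ℝ, ∀ x, |f x| ≤ M)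
    (hmul : ∀ f ∈ C, ∀ g ∈ C, (fun x => f x * g x) ∈ C) {f : α → ℝ}
    (hf : BoundedClosure C f) (t : ℝ) :
    BoundedClosure C ({x | t < f x}.indicator fun _ => 1) := by
  refine .lim 1 (f := fun n x => min 1 (max 0 ((n : ℝ) * (f x - t))))
    (fun n => hf.comp_continuous hone hC hmul (φ := fun y => min 1 (max 0 ((n : ℝ) * (y - t))))
      (by fun_prop)) (fun n x => ?_) fun x => ?_
  · rw [abs_of_nonneg (by positivity)]
    exact min_le_left _ _
  · by_cases h : t < f x
    · rw [indicator_of_mem (show x ∈ {x | t < f x} from h)]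
      refine tendsto_const_nhds.congr' ?_
      have := (tendsto_natCast_atTop_atTop (R := ℝ)).atTop_mul_const (sub_pos.2 h)
      filter_upwards [this.eventually_ge_atTop 1] with n hn
      rw [max_eq_right (by linarith), min_eq_left hn]
    · rw [indicator_of_notMem (show x ∉ {x | t < f x} from h)]
      refine tendsto_const_nhds.congr fun n => ?_
      rw [max_eq_left, min_eq_right zero_le_one]
      exact mul_nonpos_of_nonneg_of_nonpos n.cast_nonneg (by linarith [not_lt.1 h])

/-- A multiplicative class of bounded functions generates the indicators of the measurable sets of
the σ-algebra it generates. -/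
theorem indicator_of_measurableSet [MeasurableSpace α] (hone : (fun _ => 1) ∈ C)
    (hC : ∀ f ∈ C, ∃ M : ℝ, ∀ x, |f x| ≤ M)
    (hmul : ∀ f ∈ C, ∀ g ∈ C, (fun x => f x * g x) ∈ C)
    (hgen : ‹MeasurableSpace α› ≤
      MeasurableSpace.generateFrom {s | ∃ f ∈ C, ∃ t : ℝ, s = {x | t < f x}})
    {s : Set α} (hs : MeasurableSet s) : BoundedClosure C (s.indicator fun _ => 1) := by
  have hcompl : ∀ s : Set α, BoundedClosure C (s.indicator fun _ => 1) →
      BoundedClosure C (sᶜ.indicator fun _ => 1) := fun s h => by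
    have := (BoundedClosure.basic hone).add (h.smul (-1))
    convert this using 1
    funext x
    by_cases hx : x ∈ s <;> simp [hx]
  have hinter : ∀ s t : Set α, BoundedClosure C (s.indicator fun _ => 1) →
      BoundedClosure C (t.indicator fun _ => 1) →
      BoundedClosure C ((s ∩ t).indicator fun _ => 1) := fun s t h₁ h₂ => by
    convert h₁.mul hC hmul h₂ using 1
    funext x
    by_cases hx : x ∈ s <;> by_cases hy : x ∈ t <;> simp [hx, hy]
  have hempty : BoundedClosure C ((∅ : Set α).indicator fun _ => 1) := by
    simpa using (BoundedClosure.basic hone).smul 0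
  refine MeasurableSpace.generateFrom_induction _
    (fun s _ => BoundedClosure C (s.indicator fun _ => 1)) ?_ hempty
    (fun s _ h => hcompl s h) (fun s _ h => ?_) s (hgen s hs)
  · rintro _ ⟨f, hf, t, rfl⟩ _
    exact (BoundedClosure.basic hf).indicator_lt hone hC hmul t
  -- Finite unions come from complements and intersections; a countable union is the pointwise limit
  -- of its partial unions.
  · have hacc : ∀ n, BoundedClosure C ((accumulate s n).indicator fun _ => 1) := by
      intro n
      induction n with
      | zero => simpa [accumulate_zero_nat] using h 0
      | succ n ih =>
        rw [accumulate_succ]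
        convert hcompl _ (hinter _ _ (hcompl _ ih) (hcompl _ (h (n + 1)))) using 2
        rw [← compl_union, compl_compl]
    refine .lim 1 hacc (fun n x => ?_) fun x => ?_
    · by_cases hx : x ∈ accumulate s n <;> simp [hx]
    · rw [← iUnion_accumulate]
      exact monotone_accumulate.tendsto_indicator _ _ x |>.mono_right (pure_le_nhds _)

end BoundedClosure

/-- A family of finite measures is measurable as soon as the integrals of the members of a
multiplicative generating class of bounded functions are. -/
theorem measurable_measure_of_multiplicative {α β : Type*} [MeasurableSpace α] [MeasurableSpace β]
    {μ : α → Measure β} [∀ a, IsFiniteMeasure (μ a)] {C : Set (β → ℝ)}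
    (hone : (fun _ => 1) ∈ C) (hC : ∀ f ∈ C, ∃ M : ℝ, ∀ x, |f x| ≤ M)
    (hmul : ∀ f ∈ C, ∀ g ∈ C, (fun x => f x * g x) ∈ C) (hCm : ∀ f ∈ C, Measurable f)
    (hgen : ‹MeasurableSpace β› ≤
      MeasurableSpace.generateFrom {s | ∃ f ∈ C, ∃ t : ℝ, s = {x | t < f x}})
    (hμ : ∀ f ∈ C, Measurable fun a => ∫ x, f x ∂(μ a)) : Measurable μ := by
  have key : ∀ f, BoundedClosure C f → Measurable f ∧ Measurable fun a => ∫ x, f x ∂(μ a) := by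
    intro f hf
    have hint : ∀ g : β → ℝ, BoundedClosure C g → Measurable g → ∀ a, Integrable g (μ a) := by
      intro g hg hgm a
      obtain ⟨M, hM⟩ := hg.bounded hC
      exact Integrable.of_bound hgm.aestronglyMeasurable M (Eventually.of_forall hM)
    induction hf with
    | basic hf => exact ⟨hCm _ hf, hμ _ hf⟩
    | add hf hg ih₁ ih₂ =>
      refine ⟨ih₁.1.add ih₂.1, ?_⟩
      simp_rw [fun a => integral_add (hint _ hf ih₁.1 a) (hint _ hg ih₂.1 a)]
      exact ih₁.2.add ih₂.2
    | smul c _ ih =>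
      refine ⟨ih.1.const_mul c, ?_⟩
      simp_rw [integral_const_mul]
      exact ih.2.const_mul c
    | lim M _ hM hg ih =>
      refine ⟨measurable_of_tendsto_metrizable (fun n => (ih n).1) (tendsto_pi_nhds.2 hg), ?_⟩
      refine measurable_of_tendsto_metrizable (fun n => (ih n).2) (tendsto_pi_nhds.2 fun a => ?_)
      exact tendsto_integral_of_dominated_convergence (fun _ => M)
        (fun n => (ih n).1.aestronglyMeasurable) (integrable_const M)
        (fun n => Eventually.of_forall (hM n)) (Eventually.of_forall hg)
  refine Measure.measurable_of_measurable_coe _ fun s hs => ?_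
  have h := (key _ (BoundedClosure.indicator_of_measurableSet hone hC hmul hgen hs)).2
  simp_rw [integral_indicator_const (1 : ℝ) hs, smul_eq_mul, mul_one] at h
  simpa [Measure.real] using h.ennreal_ofReal

end NonlocalBranching
-- Compactness of Markov kernels into the unit interval.
namespace NonlocalBranching

/-- From a decreasing sequence of midpoint convex families of uniformly bounded functions one can
select an almost everywhere convergent sequence. -/
theorem exists_seq_ae_tendsto_of_midpoint {X Y : Type*} [MeasurableSpace Y] (μ : Measure Y)
    [IsFiniteMeasure μ] (N : X → Y → ℝ) (hN : ∀ x, Measurable (N x)) (hb : ∀ x y, |N x y| ≤ 1)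
    (S : ℕ → Set X) (hne : ∀ m, (S m).Nonempty) (hanti : Antitone S)
    (hmid : ∀ m, ∀ x ∈ S m, ∀ y ∈ S m, ∃ z ∈ S m, ∀ p, N z p = (N x p + N y p) / 2) :
    ∃ u : ℕ → X, (∀ m, u m ∈ S m) ∧
      ∀ᵐ p ∂μ, ∃ l : ℝ, Tendsto (fun m => N (u m) p) atTop (𝓝 l) := by
  have hsq : ∀ x p, (N x p) ^ 2 ≤ 1 := fun x p => by
    rw [← sq_abs]; exact pow_le_one₀ (abs_nonneg _) (hb x p)
  have hint : ∀ x, Integrable (fun p => (N x p) ^ 2) μ := fun x =>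
    Integrable.of_bound ((hN x).pow_const 2).aestronglyMeasurable 1
      (Eventually.of_forall fun p => by rw [Real.norm_eq_abs, abs_of_nonneg (sq_nonneg _)]; exact hsq x p)
  -- Near-minimisers of the squared `L²` norm over shrinking midpoint convex sets form a Cauchy
  -- sequence, by the parallelogram identity. The infima over `S m` increase with `m` to a finite
  -- limit `D`.
  set J : X → ℝ := fun x => ∫ p, (N x p) ^ 2 ∂μ with hJ
  have hJ0 : ∀ x, 0 ≤ J x := fun x => integral_nonneg fun p => sq_nonneg _
  have hJ1 : ∀ x, J x ≤ μ.real univ := fun x => by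
    simpa using integral_mono (hint x) (integrable_const (1 : ℝ)) (hsq x)
  have hbdd : ∀ m, BddBelow (J '' S m) := fun m => ⟨0, by rintro _ ⟨x, -, rfl⟩; exact hJ0 x⟩
  set d : ℕ → ℝ := fun m => sInf (J '' S m) with hd
  have hdJ : ∀ m, ∀ x ∈ S m, d m ≤ J x := fun m x hx => csInf_le (hbdd m) ⟨x, hx, rfl⟩
  have hdmono : Monotone d := fun m n hmn =>
    csInf_le_csInf (hbdd m) ((hne n).image _) (image_mono (hanti hmn))
  have hdb : BddAbove (range d) := ⟨μ.real univ, by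
    rintro _ ⟨m, rfl⟩
    obtain ⟨x, hx⟩ := hne m
    exact (hdJ m x hx).trans (hJ1 x)⟩
  have htend := tendsto_atTop_ciSup hdmono hdb
  set D : ℝ := ⨆ m, d m with hD
  have hdD : ∀ m, d m ≤ D := fun m => le_ciSup hdb m
  -- The squared `L²` distances will be at most `8 ε n = 4⁻ⁿ / 2`, which is below the square of
  -- `2⁻ⁿ`; the latter is summable and so yields almost everywhere convergence.
  set ε : ℕ → ℝ := fun j => (1 / 4 : ℝ) ^ j / 16 with hε
  have hεpos : ∀ j, 0 < ε j := fun j => by positivity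
  have hεanti : ∀ {i j}, i ≤ j → ε j ≤ ε i := fun {i j} hij => by
    simp only [hε]
    gcongr ?_ / 16
    exact pow_le_pow_of_le_one (by norm_num) (by norm_num) hij
  obtain ⟨φ, hφ, hφD⟩ := extraction_forall_of_eventually
    (fun j => htend.eventually (lt_mem_nhds (sub_lt_self D (hεpos j))))
  have hsel : ∀ j, ∃ x ∈ S (φ j), J x < D + ε j := fun j => by
    obtain ⟨_, ⟨x, hx, rfl⟩, hlt⟩ := exists_lt_of_csInf_lt ((hne (φ j)).image J)
      (show sInf (J '' S (φ j)) < D + ε j from (hdD _).trans_lt (by linarith [hεpos j]))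
    exact ⟨x, hx, hlt⟩
  choose u huS huJ using hsel
  refine ⟨u, fun m => hanti (hφ.id_le m) (huS m), ?_⟩
  have hdist : ∀ n i j, n ≤ i → n ≤ j → ∫ p, (N (u i) p - N (u j) p) ^ 2 ∂μ ≤ 8 * ε n := by
    intro n i j hi hj
    obtain ⟨z, hz, hzN⟩ := hmid (φ n) _ (hanti (hφ.monotone hi) (huS i)) _
      (hanti (hφ.monotone hj) (huS j))
    -- The midpoint `z` still lies in `S (φ n)`, hence `J z > D - ε n`, while both endpoints have `J
    -- < D + ε n`.
    have hpar : ∫ p, (N (u i) p - N (u j) p) ^ 2 ∂μ = 2 * J (u i) + 2 * J (u j) - 4 * J z := by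
      simp only [hJ, ← integral_const_mul]
      have h12 : Integrable (fun p => 2 * N (u i) p ^ 2 + 2 * N (u j) p ^ 2) μ :=
        ((hint _).const_mul _).add ((hint _).const_mul _)
      rw [← integral_add ((hint _).const_mul _) ((hint _).const_mul _),
        ← integral_sub h12 ((hint _).const_mul _)]
      congr 1
      funext p
      rw [hzN p]
      ring
    have h1 := hdJ _ z hz
    have h2 := hφD n
    have h3 := huJ i
    have h4 := huJ j
    have h5 := hεanti hi
    have h6 := hεanti hj
    rw [hpar]
    linarith
  refine Lp.ae_tendsto_of_cauchy_eLpNorm (p := 2) (f := fun m => N (u m))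
    (fun m => (hN _).aestronglyMeasurable) (by norm_num) (B := fun n => (1 / 2 : ℝ≥0∞) ^ n) ?_ ?_
  · rw [ENNReal.tsum_geometric]
    simp
  · intro n i j hi hj
    have hmem : MemLp (N (u i) - N (u j)) 2 μ := by
      refine MemLp.of_bound ((hN _).sub (hN _)).aestronglyMeasurable 2 (Eventually.of_forall ?_)
      intro p
      rw [Pi.sub_apply, Real.norm_eq_abs]
      have h1 := hb (u i) p
      have h2 := hb (u j) p
      rw [abs_le] at *
      constructor <;> linarith [h1.1, h1.2, h2.1, h2.2]
    rw [hmem.eLpNorm_eq_integral_rpow_norm (by norm_num) (by norm_num)]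
    have hlt : (∫ p, ‖(N (u i) - N (u j)) p‖ ^ (2 : ℝ≥0∞).toReal ∂μ) ^ (2 : ℝ≥0∞).toReal⁻¹
        < (1 / 2 : ℝ) ^ n := by
      have h1 := hdist n i j hi hj
      simp only [Pi.sub_apply, Real.norm_eq_abs, ENNReal.toReal_ofNat, Real.rpow_ofNat, sq_abs]
      rw [← one_div, ← Real.sqrt_eq_rpow, Real.sqrt_lt' (by positivity)]
      refine h1.trans_lt ?_
      simp only [hε]
      rw [← pow_mul, mul_comm n 2, pow_mul]
      norm_num
      rw [← mul_div_assoc, div_lt_iff₀ (by norm_num)]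
      have : (0 : ℝ) < (1 / 4) ^ n := by positivity
      linarith
    calc _ < ENNReal.ofReal ((1 / 2 : ℝ) ^ n) :=
          (ENNReal.ofReal_lt_ofReal_iff (by positivity)).2 hlt
      _ = (1 / 2 : ℝ≥0∞) ^ n := by
          rw [ENNReal.ofReal_pow (by norm_num), ENNReal.ofReal_div_of_pos (by norm_num)]
          simp

open unitInterval

/-- Compactness of the probability measures on `[0, 1]` gives a limit along an ultrafilter. Its
moments are the limits of the full moment sequences, and density of polynomials upgrades this to
convergence along `atTop` for every continuous function. -/
theorem exists_tendsto_integral_of_moments (p : ℕ → ProbabilityMeasure I)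
    (h : ∀ j : ℕ, ∃ l : ℝ, Tendsto (fun m => ∫ t, (t : ℝ) ^ j ∂(p m : Measure I)) atTop (𝓝 l)) :
    ∃ q : ProbabilityMeasure I, ∀ g : C(I, ℝ),
      Tendsto (fun m => ∫ t, g t ∂(p m : Measure I)) atTop (𝓝 (∫ t, g t ∂(q : Measure I))) := by
  have hint : ∀ (r : ProbabilityMeasure I) (g : C(I, ℝ)), Integrable g (r : Measure I) :=
    fun r g => (BoundedContinuousFunction.mkOfCompact g).integrable _
  set U : Ultrafilter ℕ := hyperfilter ℕ
  have hU : (U : Filter ℕ) ≤ atTop := Nat.hyperfilter_le_atTop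
  obtain ⟨q, -, hq⟩ := isCompact_univ.ultrafilter_le_nhds (U.map p) (by simp)
  have hq' : ∀ g : C(I, ℝ), Tendsto (fun m => ∫ t, g t ∂(p m : Measure I)) U
      (𝓝 (∫ t, g t ∂(q : Measure I))) := fun g =>
    (ProbabilityMeasure.tendsto_iff_forall_integral_tendsto (F := (U : Filter ℕ)) (μs := p)).1 hq
      (BoundedContinuousFunction.mkOfCompact g)
  refine ⟨q, ?_⟩
  have hmono : ∀ j : ℕ, Tendsto (fun m => ∫ t, (t : ℝ) ^ j ∂(p m : Measure I)) atTop
      (𝓝 (∫ t, (t : ℝ) ^ j ∂(q : Measure I))) := fun j => by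
    obtain ⟨l, hl⟩ := h j
    have h2 : Tendsto (fun m => ∫ t, (t : ℝ) ^ j ∂(p m : Measure I)) U
      (𝓝 (∫ t, (t : ℝ) ^ j ∂(q : Measure I))) := hq' ⟨fun t : I => (t : ℝ) ^ j, by fun_prop⟩
    rwa [← tendsto_nhds_unique (hl.mono_left hU) h2]
  have hpoly : ∀ P : Polynomial ℝ, Tendsto (fun m => ∫ t : I, P.eval (t : ℝ) ∂(p m : Measure I))
      atTop (𝓝 (∫ t : I, P.eval (t : ℝ) ∂(q : Measure I))) := by
    intro P
    have hi : ∀ (r : ProbabilityMeasure I), ∫ t : I, P.eval (t : ℝ) ∂(r : Measure I) =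
        ∑ i ∈ Finset.range (P.natDegree + 1), P.coeff i * ∫ t : I, (t : ℝ) ^ i ∂(r : Measure I) := by
      intro r
      simp_rw [Polynomial.eval_eq_sum_range]
      rw [integral_finsetSum]
      · simp_rw [integral_const_mul]
      · intro i _
        exact (hint r ⟨fun t : I => (t : ℝ) ^ i, by fun_prop⟩).const_mul _
    simp_rw [hi]
    exact tendsto_finsetSum _ fun i _ => (hmono i).const_mul _
  intro g
  rw [Metric.tendsto_atTop]
  intro ε hε
  obtain ⟨P, hP⟩ := exists_polynomial_near_continuousMap 0 1 g (ε / 4) (by positivity)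
  have hclose : ∀ r : ProbabilityMeasure I,
      |∫ t, g t ∂(r : Measure I) - ∫ t : I, P.eval (t : ℝ) ∂(r : Measure I)| ≤ ε / 4 := by
    intro r
    have hiP : Integrable (fun t : I => P.eval (t : ℝ)) (r : Measure I) :=
      hint r (P.toContinuousMapOn (Icc 0 1))
    rw [← integral_sub (hint r g) hiP]
    have := norm_integral_le_of_norm_le_const (μ := (r : Measure I)) (C := ε / 4)
      (f := fun t : I => g t - P.eval (t : ℝ)) (Eventually.of_forall fun t => by
        have := ContinuousMap.norm_coe_le_norm (P.toContinuousMapOn (Icc 0 1) - g) t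
        rw [ContinuousMap.sub_apply, ← norm_neg, neg_sub] at this
        exact this.trans hP.le)
    simpa using this
  obtain ⟨n, hn⟩ := Metric.tendsto_atTop.1 (hpoly P) (ε / 4) (by positivity)
  refine ⟨n, fun m hm => ?_⟩
  have h1 := hn m hm
  have h2 := hclose (p m)
  have h3 := hclose q
  rw [Real.dist_eq] at *
  rw [abs_lt] at *
  rw [abs_le] at *
  constructor <;> linarith [h1.1, h1.2, h2.1, h2.2, h3.1, h3.2]

theorem measurable_measure_of_moments {α : Type*} [MeasurableSpace α] {μ : α → Measure I}
    [∀ a, IsFiniteMeasure (μ a)] (h : ∀ j : ℕ, Measurable fun a => ∫ t, (t : ℝ) ^ j ∂(μ a)) :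
    Measurable μ := by
  refine measurable_measure_of_multiplicative (C := range fun (j : ℕ) (t : I) => (t : ℝ) ^ j)
    ⟨0, by simp⟩ ?_ ?_ ?_ ?_ ?_
  · rintro _ ⟨j, rfl⟩
    exact ⟨1, fun t => by
      rw [abs_of_nonneg (pow_nonneg t.2.1 _)]; exact pow_le_one₀ t.2.1 t.2.2⟩
  · rintro _ ⟨i, rfl⟩ _ ⟨j, rfl⟩
    exact ⟨i + j, by simp [pow_add]⟩
  · rintro _ ⟨j, rfl⟩
    fun_prop
  · rw [BorelSpace.measurable_eq (α := I), borel_eq_generateFrom_Ioi]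
    refine MeasurableSpace.generateFrom_mono ?_
    rintro _ ⟨a, rfl⟩
    exact ⟨_, ⟨1, rfl⟩, a, by ext t; simp⟩
  · rintro _ ⟨j, rfl⟩
    exact h j

/-- Compactness of Young measures: a sequence of Markov kernels into the unit interval has a limit
kernel against all bounded Carathéodory integrands along which the integrals converge. -/
theorem exists_kernel_of_tendsto {Ω : Type*} [MeasurableSpace Ω] (P : Measure Ω)
    [IsProbabilityMeasure P] (κ : ℕ → Kernel Ω I) [∀ k, IsMarkovKernel (κ k)] {ι : Type*}
    (F : ι → Ω → I → ℝ) (hF : ∀ i, Measurable fun p : Ω × I => F i p.1 p.2)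
    (hcont : ∀ i ω, Continuous (F i ω)) (hbdd : ∀ i, ∃ C : ℝ, ∀ ω t, |F i ω t| ≤ C) (L : ι → ℝ)
    (hL : ∀ i, Tendsto (fun k => ∫ ω, ∫ t, F i ω t ∂(κ k ω) ∂P) atTop (𝓝 (L i))) :
    ∃ η : Kernel Ω I, IsMarkovKernel η ∧ ∀ i, ∫ ω, ∫ t, F i ω t ∂(η ω) ∂P = L i := by
  classical
  let X := {η : Kernel Ω I // IsMarkovKernel η}
  have hX : ∀ x : X, IsMarkovKernel x.1 := fun x => x.2
  have hXω : ∀ (x : X) (ω : Ω), IsProbabilityMeasure (x.1 ω) := fun x ω => inferInstance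
  set A : X → ι → ℝ := fun x i => ∫ ω, ∫ t, F i ω t ∂(x.1 ω) ∂P with hA
  have hFint : ∀ (x : X) i ω, Integrable (F i ω) (x.1 ω) := fun x i ω => by
    obtain ⟨C, hC⟩ := hbdd i
    exact Integrable.of_bound (hcont i ω).aestronglyMeasurable C (Eventually.of_forall (hC ω))
  have hFm : ∀ (x : X) i, Measurable fun ω => ∫ t, F i ω t ∂(x.1 ω) := fun x i =>
    ((hF i).stronglyMeasurable.integral_kernel_prod_right (κ := x.1)).measurable
  have hFb : ∀ (x : X) i C, (∀ ω t, |F i ω t| ≤ C) → ∀ ω, |∫ t, F i ω t ∂(x.1 ω)| ≤ C :=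
    fun x i C hC ω => by
      simpa using norm_integral_le_of_norm_le_const (μ := x.1 ω) (f := F i ω) (C := C)
        (Eventually.of_forall (hC ω))
  have hFI : ∀ (x : X) i, Integrable (fun ω => ∫ t, F i ω t ∂(x.1 ω)) P := fun x i => by
    obtain ⟨C, hC⟩ := hbdd i
    exact Integrable.of_bound (hFm x i).aestronglyMeasurable C
      (Eventually.of_forall (hFb x i C hC))
  -- These are the kernels that satisfy every bound `|A · i - L i| ≤ ε` shared by all `κ k` with `k
  -- ≥ m`. Such sets are midpoint convex, decrease with `m`, and force `A (u m) i → L i` for all `i`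
  -- at once, so an uncountable index set needs no diagonal extraction.
  set S : ℕ → Set X := fun m => {x | ∀ i, ∀ ε : ℝ,
    (∀ k, m ≤ k → |A ⟨κ k, inferInstance⟩ i - L i| ≤ ε) → |A x i - L i| ≤ ε} with hS
  have hmidpoint : ∀ x y : X, ∃ z : X, ∀ ω (g : I → ℝ), Integrable g (x.1 ω) →
      Integrable g (y.1 ω) → ∫ t, g t ∂(z.1 ω) = (∫ t, g t ∂(x.1 ω) + ∫ t, g t ∂(y.1 ω)) / 2 := by
    intro x y
    refine ⟨⟨⟨fun ω => (2⁻¹ : ℝ≥0∞) • (x.1 ω + y.1 ω), ?_⟩, ⟨fun ω => ⟨?_⟩⟩⟩, ?_⟩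
    · exact Measure.measurable_of_measurable_coe _ fun s hs => 
        ((x.1.measurable_coe hs).add (y.1.measurable_coe hs)).const_mul _
    · change ((2⁻¹ : ℝ≥0∞) • (x.1 ω + y.1 ω)) univ = 1
      simp only [Measure.smul_apply, Measure.add_apply, measure_univ, smul_eq_mul]
      rw [one_add_one_eq_two, ENNReal.inv_mul_cancel (by norm_num) (by norm_num)]
    · intro ω g h1 h2
      change ∫ t, g t ∂((2⁻¹ : ℝ≥0∞) • (x.1 ω + y.1 ω)) = _
      rw [integral_smul_measure, integral_add_measure h1 h2]
      simp
      ring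
  -- A finite measure charging every exponent `j`: one almost everywhere statement on `Ω × ℕ` then
  -- handles all moments simultaneously.
  set w : Measure ℕ := Measure.sum fun j : ℕ => ((1 / 2 : ℝ≥0∞) ^ j) • Measure.dirac j with hw
  have hwfin : IsFiniteMeasure w := ⟨by
    simp only [hw, Measure.sum_apply _ MeasurableSet.univ, Measure.smul_apply, measure_univ,
      smul_eq_mul, mul_one, ENNReal.tsum_geometric]
    simp⟩
  have hwae : ∀ p : ℕ → Prop, (∀ᵐ j ∂w, p j) → ∀ j, p j := by
    intro p hp j
    have h := (Measure.ae_sum_iff.1 hp) j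
    rw [Measure.ae_ennreal_smul_measure_eq (pow_ne_zero _ (by simp))] at h
    simpa using h
  have hmonint : ∀ (x : X) (j : ℕ) ω, Integrable (fun t : I => (t : ℝ) ^ j) (x.1 ω) :=
    fun x j ω => Integrable.of_bound (by fun_prop) 1 (Eventually.of_forall fun t => by
      rw [Real.norm_eq_abs, abs_of_nonneg (pow_nonneg t.2.1 _)]; exact pow_le_one₀ t.2.1 t.2.2)
  have hmonm : ∀ (x : X) (j : ℕ), Measurable fun ω => ∫ t, (t : ℝ) ^ j ∂(x.1 ω) := fun x j =>
    (StronglyMeasurable.integral_kernel_prod_right (κ := x.1) (f := fun _ (t : I) => (t : ℝ) ^ j)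
      (by fun_prop)).measurable
  obtain ⟨u, huS, hu⟩ := exists_seq_ae_tendsto_of_midpoint (P.prod w)
    (fun (x : X) (p : Ω × ℕ) => ∫ t, (t : ℝ) ^ p.2 ∂(x.1 p.1))
    (fun x => measurable_from_prod_countable_left fun j => hmonm x j)
    (fun x p => by
      have := norm_integral_le_of_norm_le_const (μ := x.1 p.1) (f := fun t : I => (t : ℝ) ^ p.2)
        (C := 1) (Eventually.of_forall fun t => by
          rw [Real.norm_eq_abs, abs_of_nonneg (pow_nonneg t.2.1 _)]
          exact pow_le_one₀ t.2.1 t.2.2)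
      simpa using this)
    S (fun m => ⟨⟨κ m, inferInstance⟩, fun i ε h => h m le_rfl⟩)
    (fun m n hmn x hx i ε h => hx i ε fun k hk => h k (hmn.trans hk))
    (fun m x hx y hy => by
      obtain ⟨z, hz⟩ := hmidpoint x y
      refine ⟨z, fun i ε h => ?_, fun p => hz p.1 _ (hmonint x _ _) (hmonint y _ _)⟩
      have hAz : A z i = (A x i + A y i) / 2 := by
        simp only [hA]
        simp_rw [fun ω => hz ω _ (hFint x i ω) (hFint y i ω)]
        rw [integral_div, integral_add (hFI x i) (hFI y i)]
      have h1 := hx i ε h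
      have h2 := hy i ε h
      rw [hAz]
      rw [abs_le] at *
      constructor <;> linarith [h1.1, h1.2, h2.1, h2.2])
  have hAu : ∀ i, Tendsto (fun m => A (u m) i) atTop (𝓝 (L i)) := by
    intro i
    rw [Metric.tendsto_atTop]
    intro ε hε
    obtain ⟨n, hn⟩ := Metric.tendsto_atTop.1 (hL i) (ε / 2) (by positivity)
    refine ⟨n, fun m hm => ?_⟩
    rw [Real.dist_eq]
    exact (huS m i (ε / 2) fun k hk => (hn k (hm.trans hk)).le).trans_lt (by linarith)
  set good : Set Ω := {ω | ∀ j : ℕ, ∃ l : ℝ,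
    Tendsto (fun m => ∫ t, (t : ℝ) ^ j ∂((u m).1 ω)) atTop (𝓝 l)} with hgood
  have hgm : MeasurableSet good := by
    simp only [hgood, ofPred_forall]
    exact MeasurableSet.iInter fun j => measurableSet_exists_tendsto fun m => hmonm (u m) j
  have hgae : ∀ᵐ ω ∂P, ω ∈ good := by
    filter_upwards [Measure.ae_ae_of_ae_prod hu] with ω hω
    exact hwae _ hω
  have hlim : ∀ ω, ∃ q : ProbabilityMeasure I, ω ∈ good → ∀ g : C(I, ℝ),
      Tendsto (fun m => ∫ t, g t ∂((u m).1 ω)) atTop (𝓝 (∫ t, g t ∂(q : Measure I))) := by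
    intro ω
    by_cases h : ω ∈ good
    · obtain ⟨q, hq⟩ := exists_tendsto_integral_of_moments (fun m => ⟨(u m).1 ω, inferInstance⟩) h
      exact ⟨q, fun _ => hq⟩
    · exact ⟨⟨Measure.dirac 0, inferInstance⟩, fun h' => absurd h' h⟩
  choose q hq using hlim
  -- On the measurable set where all moments converge, `η` is the weak limit; on its complement,
  -- which is `P`-null, any fixed probability measure will do.
  set η : Ω → Measure I := fun ω => if ω ∈ good then (q ω : Measure I) else Measure.dirac 0 with hη
  have hηp : ∀ ω, IsProbabilityMeasure (η ω) := fun ω => by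
    simp only [hη]; split_ifs <;> infer_instance
  have hηm : Measurable η := by
    refine measurable_measure_of_moments fun j => ?_
    refine measurable_of_tendsto_metrizable (f := fun m ω =>
      if ω ∈ good then ∫ t, (t : ℝ) ^ j ∂((u m).1 ω) else (0 : ℝ) ^ j)
      (fun m => Measurable.ite hgm (hmonm (u m) j) measurable_const) (tendsto_pi_nhds.2 fun ω => ?_)
    by_cases h : ω ∈ good
    · simp only [hη, h, if_true]
      exact hq ω h ⟨fun t : I => (t : ℝ) ^ j, by fun_prop⟩
    · simp [hη, h]
  refine ⟨⟨η, hηm⟩, ⟨hηp⟩, fun i => ?_⟩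
  obtain ⟨C, hC⟩ := hbdd i
  refine tendsto_nhds_unique (tendsto_integral_of_dominated_convergence (fun _ => C)
    (fun m => (hFm (u m) i).aestronglyMeasurable) (integrable_const C)
    (fun m => Eventually.of_forall (hFb (u m) i C hC)) ?_) (hAu i)
  filter_upwards [hgae] with ω hω
  simp only [Kernel.coe_mk, hη, hω, if_true]
  exact hq ω hω ⟨F i ω, hcont i ω⟩

end NonlocalBranching
-- The Laplace quotient on the compactified half-line.
namespace NonlocalBranching

open unitInterval

/-- Because `(1 + x) (1 - x + x²) = 1 + x³ ≥ 1` and `exp x ≥ 1 + x`. -/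
theorem exp_neg_le_quadratic {x : ℝ} (hx : 0 ≤ x) : Real.exp (-x) ≤ 1 - x + x ^ 2 := by
  rw [Real.exp_neg, inv_le_comm₀ (Real.exp_pos x) (by nlinarith [sq_nonneg (x - 1)])]
  refine le_trans ?_ (Real.add_one_le_exp x)
  rw [inv_le_iff_one_le_mul₀ (by nlinarith [sq_nonneg (x - 1)])]
  nlinarith [pow_nonneg hx 3]

theorem abs_exp_neg_sub_le {x : ℝ} (hx : 0 ≤ x) : |Real.exp (-x) - (1 - x)| ≤ x ^ 2 := by
  rw [abs_le]
  constructor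
  · nlinarith [Real.add_one_le_exp (-x)]
  · linarith [exp_neg_le_quadratic hx]

/-- `(1 - exp(-u s)) / u`, extended continuously to `u ∈ [0, ∞]` and read in the coordinate
`t = 1 / (1 + u)`. -/
noncomputable def laplaceQuotient (s : ℝ) (t : I) : ℝ :=
  if (t : ℝ) = 1 then s else t / (1 - t) * (1 - Real.exp (-((1 - t) / t * s)))

/-- The point `1 / (1 + u)` of the unit interval. -/
noncomputable def toUnit (u : PosReal) : I :=
  ⟨1 / (1 + u.1), by
    have := u.2
    exact ⟨by positivity, (div_le_one (by positivity)).2 (by linarith)⟩⟩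

/-- The inverse of `toUnit` on `(0, 1)`, with value one elsewhere. -/
noncomputable def ofUnit (t : I) : PosReal :=
  if h : 0 < (1 - (t : ℝ)) / t then ⟨(1 - t) / t, h⟩ else ⟨1, one_pos⟩

@[fun_prop]
theorem measurable_toUnit : Measurable toUnit :=
  Measurable.subtype_mk (by fun_prop)

@[fun_prop]
theorem measurable_ofUnit : Measurable ofUnit := by
  refine Measurable.subtype_mk (f := fun t : I => ((ofUnit t : PosReal) : ℝ)) (h := fun t => (ofUnit t).2) ?_
  have : (fun t : I => ((ofUnit t : PosReal) : ℝ)) =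
      fun t : I => if 0 < (1 - (t : ℝ)) / t then (1 - (t : ℝ)) / t else 1 := by
    funext t
    simp only [ofUnit]
    split_ifs <;> rfl
  rw [this]
  refine Measurable.ite ?_ (by fun_prop) measurable_const
  exact measurableSet_lt measurable_const (by fun_prop)

theorem ofUnit_coe {t : I} (h0 : 0 < t) (h1 : t < 1) : (ofUnit t).1 = (1 - (t : ℝ)) / t := by
  have h0' : (0 : ℝ) < t := h0
  have h1' : (t : ℝ) < 1 := h1
  rw [ofUnit, dif_pos (div_pos (by linarith) h0')]

theorem laplaceQuotient_one (s : ℝ) : laplaceQuotient s 1 = s := by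
  simp [laplaceQuotient]

/-- The vanishing at `u = ∞` is what allows a subprobability to be completed to a probability
without changing any functional. -/
theorem laplaceQuotient_zero (s : ℝ) : laplaceQuotient s 0 = 0 := by
  simp [laplaceQuotient]

theorem laplaceQuotient_of_mem_Ioo {t : I} (h0 : 0 < t) (h1 : t < 1) (s : ℝ) :
    laplaceQuotient s t = (1 - Real.exp (-((ofUnit t).1 * s))) / (ofUnit t).1 := by
  have h1' : (t : ℝ) < 1 := h1
  rw [laplaceQuotient, if_neg h1'.ne, ofUnit_coe h0 h1, div_eq_mul_inv _ ((1 - (t : ℝ)) / t),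
    inv_div, mul_comm]

theorem laplaceQuotient_toUnit (s : ℝ) (u : PosReal) :
    laplaceQuotient s (toUnit u) = (1 - Real.exp (-(u.1 * s))) / u.1 := by
  have hu := u.2
  have h0 : (0 : I) < toUnit u := by
    change (0 : ℝ) < 1 / (1 + u.1)
    positivity
  have h1 : toUnit u < 1 := by
    change 1 / (1 + u.1) < (1 : ℝ)
    rw [div_lt_one (by positivity)]
    linarith
  have h2 : (ofUnit (toUnit u)).1 = u.1 := by
    rw [ofUnit_coe h0 h1]
    simp only [toUnit]
    field_simp
    ring
  rw [laplaceQuotient_of_mem_Ioo h0 h1, h2]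

theorem measurable_laplaceQuotient : Measurable fun p : ℝ × I => laplaceQuotient p.1 p.2 := by
  unfold laplaceQuotient
  refine Measurable.ite ?_ (by fun_prop) (by fun_prop)
  exact (measurableSet_singleton (1 : ℝ)).preimage (measurable_subtype_coe.comp measurable_snd)

/-- The bounds `s - u s²` and `s` squeeze the quotient at `u = 0`, and `0` and `1 / u` squeeze it at
`u = ∞`; this is the continuity at the two endpoints. -/
theorem one_sub_exp_neg_div_bounds {u s : ℝ} (hu : 0 < u) (hs : 0 ≤ s) :
    0 ≤ (1 - Real.exp (-(u * s))) / u ∧ (1 - Real.exp (-(u * s))) / u ≤ s ∧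
      (1 - Real.exp (-(u * s))) / u ≤ 1 / u ∧ s - u * s ^ 2 ≤ (1 - Real.exp (-(u * s))) / u := by
  have hus : 0 ≤ u * s := by positivity
  refine ⟨div_nonneg ?_ hu.le, ?_, ?_, ?_⟩
  · linarith [Real.exp_le_one_iff.2 (neg_nonpos.2 hus)]
  · rw [div_le_iff₀ hu]
    nlinarith [Real.add_one_le_exp (-(u * s))]
  · gcongr
    linarith [Real.exp_pos (-(u * s))]
  · rw [le_div_iff₀ hu]
    nlinarith [exp_neg_le_quadratic hus]

theorem laplaceQuotient_mem_Icc {s : ℝ} (hs : 0 ≤ s) (t : I) : laplaceQuotient s t ∈ Icc 0 s := by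
  rcases eq_or_lt_of_le (show t ≤ 1 from t.2.2) with rfl | h1
  · simpa [laplaceQuotient_one] using hs
  rcases eq_or_lt_of_le (show 0 ≤ t from t.2.1) with rfl | h0
  · simpa [laplaceQuotient_zero] using hs
  rw [laplaceQuotient_of_mem_Ioo h0 h1]
  have := one_sub_exp_neg_div_bounds (ofUnit t).2 hs
  exact ⟨this.1, this.2.1⟩

theorem continuous_laplaceQuotient {s : ℝ} (hs : 0 ≤ s) : Continuous (laplaceQuotient s) := by
  rw [continuous_iff_continuousAt]
  intro t
  rcases eq_or_lt_of_le (show t ≤ 1 from t.2.2) with rfl | h1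
  · have hg : Tendsto (fun t : I => s - (1 - (t : ℝ)) / t * s ^ 2) (𝓝 1) (𝓝 s) := by
      have : ContinuousAt (fun t : I => s - (1 - (t : ℝ)) / t * s ^ 2) 1 := by
        refine continuousAt_const.sub (ContinuousAt.mul ?_ continuousAt_const)
        exact ContinuousAt.div (by fun_prop) (by fun_prop) (by simp)
      simpa [ContinuousAt] using this
    rw [ContinuousAt, laplaceQuotient_one]
    refine tendsto_of_tendsto_of_tendsto_of_le_of_le' hg tendsto_const_nhds ?_
      (Eventually.of_forall fun t => (laplaceQuotient_mem_Icc hs t).2)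
    filter_upwards [lt_mem_nhds (show (0 : I) < 1 from zero_lt_one)] with t ht
    rcases eq_or_lt_of_le (show t ≤ 1 from t.2.2) with rfl | h1
    · simp [laplaceQuotient_one]
    · rw [laplaceQuotient_of_mem_Ioo ht h1, ← ofUnit_coe ht h1]
      exact (one_sub_exp_neg_div_bounds (ofUnit t).2 hs).2.2.2
  rcases eq_or_lt_of_le (show 0 ≤ t from t.2.1) with rfl | h0
  · have hg : Tendsto (fun t : I => (t : ℝ) / (1 - t)) (𝓝 0) (𝓝 0) := by
      have : ContinuousAt (fun t : I => (t : ℝ) / (1 - t)) 0 :=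
        ContinuousAt.div (by fun_prop) (by fun_prop) (by simp)
      simpa [ContinuousAt] using this
    rw [ContinuousAt, laplaceQuotient_zero]
    refine tendsto_of_tendsto_of_tendsto_of_le_of_le' tendsto_const_nhds hg
      (Eventually.of_forall fun t => (laplaceQuotient_mem_Icc hs t).1) ?_
    filter_upwards [gt_mem_nhds h1] with t ht
    rcases eq_or_lt_of_le (show 0 ≤ t from t.2.1) with rfl | h0
    · simp [laplaceQuotient_zero]
    · rw [laplaceQuotient_of_mem_Ioo h0 ht]
      refine (one_sub_exp_neg_div_bounds (ofUnit t).2 hs).2.2.1.trans_eq ?_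
      rw [ofUnit_coe h0 ht, one_div_div]
  · have h0' : (t : ℝ) ≠ 0 := (show (0 : ℝ) < t from h0).ne'
    have h1' : (1 - (t : ℝ)) ≠ 0 := (sub_pos.2 (show (t : ℝ) < 1 from h1)).ne'
    have hc : ContinuousAt (fun t : I => (t : ℝ) / (1 - t) *
        (1 - Real.exp (-((1 - t) / t * s)))) t := by
      refine ContinuousAt.mul (ContinuousAt.div (by fun_prop) (by fun_prop) h1') ?_
      refine continuousAt_const.sub (Real.continuous_exp.continuousAt.comp ?_)
      exact ((ContinuousAt.div (by fun_prop) (by fun_prop) h0').mul continuousAt_const).neg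
    refine hc.congr ?_
    filter_upwards [gt_mem_nhds h1] with t ht
    rw [laplaceQuotient, if_neg (show (t : ℝ) < 1 from ht).ne]

/-- The offspring law of `i` particles of mass `1 / k` contributes nearly
`(1 - exp(-u s)) / u` with `u = i / k`. -/
theorem abs_particle_sub_le {k : ℝ} (hk : 0 < k) {i : ℕ} (hi : 0 < i) {s : ℝ} (hs : 0 ≤ s)
    (hsk : s ≤ k) :
    |k * (1 - (1 - s / k) ^ i) / i - (1 - Real.exp (-((i / k) * s))) / (i / k)| ≤ s ^ 2 / k := by
  have hi' : (0 : ℝ) < i := by exact_mod_cast hi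
  have hx : 0 ≤ s / k := by positivity
  have hx1 : s / k ≤ 1 := (div_le_one hk).2 hsk
  have he : Real.exp (-((i / k) * s)) = Real.exp (-(s / k)) ^ i := by
    rw [← Real.exp_nat_mul]
    congr 1
    ring
  -- The difference is `k / i` times `aⁱ - bⁱ` with `a = exp(-s / k)` and `b = 1 - s / k`, both in
  -- `[0, 1]`. Hence `|aⁱ - bⁱ| ≤ i |a - b|` with `|a - b| ≤ (s / k)²`, and the number of particles
  -- `i` cancels.
  have heq : k * (1 - (1 - s / k) ^ i) / i - (1 - Real.exp (-((i / k) * s))) / (i / k) =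
      k / i * (Real.exp (-(s / k)) ^ i - (1 - s / k) ^ i) := by
    rw [he]
    field_simp
    ring
  have h1 := abs_pow_sub_pow_le (Real.exp (-(s / k))) (1 - s / k) i
  have h2 : max |Real.exp (-(s / k))| |1 - s / k| ^ (i - 1) ≤ 1 := by
    refine pow_le_one₀ (le_max_of_le_left (abs_nonneg _)) (max_le ?_ ?_)
    · rw [abs_of_pos (Real.exp_pos _)]
      exact Real.exp_le_one_iff.2 (by linarith)
    · rw [abs_of_nonneg (by linarith)]
      linarith
  rw [heq, abs_mul, abs_of_pos (by positivity)]
  calc k / i * |Real.exp (-(s / k)) ^ i - (1 - s / k) ^ i|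
      ≤ k / i * ((s / k) ^ 2 * i * 1) := by
        gcongr
        refine h1.trans ?_
        gcongr
        exact abs_exp_neg_sub_le hx
    _ = s ^ 2 / k := by field_simp

section Splitting

variable {Y : Type*} [MeasurableSpace Y]

/-- The part of a measure carried by `u ∈ (0, ∞)`, divided by `u`. -/
noncomputable def jumpPart (ρ : Measure Y) (t : Y → I) : Measure Y :=
  (ρ.restrict (t ⁻¹' Ioo 0 1)).withDensity fun y => ENNReal.ofReal ((ofUnit (t y)).1)⁻¹

theorem withDensity_jumpPart (ρ : Measure Y) {t : Y → I} (ht : Measurable t) :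
    (jumpPart ρ t).withDensity (fun y => ENNReal.ofReal (ofUnit (t y)).1) =
      ρ.restrict (t ⁻¹' Ioo 0 1) := by
  rw [jumpPart, ← withDensity_mul _ (by fun_prop) (by fun_prop)]
  convert withDensity_one
  funext y
  have h := (ofUnit (t y)).2
  simp only [Pi.mul_apply, Pi.one_apply]
  rw [← ENNReal.ofReal_mul (by positivity), inv_mul_cancel₀ h.ne', ENNReal.ofReal_one]

theorem integral_jumpPart (ρ : Measure Y) {t : Y → I} (ht : Measurable t) (g : Y → ℝ) :
    ∫ y, g y ∂(jumpPart ρ t) = ∫ y in t ⁻¹' Ioo 0 1, g y / (ofUnit (t y)).1 ∂ρ := by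
  rw [jumpPart, integral_withDensity_eq_integral_toReal_smul (by fun_prop) (by simp)]
  refine integral_congr_ae (Eventually.of_forall fun y => ?_)
  have h := (ofUnit (t y)).2
  simp only [smul_eq_mul]
  rw [ENNReal.toReal_ofReal (by positivity), inv_mul_eq_div]

/-- The space splits according to `u = 0`, where the quotient is `s`, `0 < u < ∞`, where dividing by
`u` undoes the size-biasing, and `u = ∞`, where it is zero. The coordinate `t` is a general map so
that this serves both joint laws on `M₀(E) × [0, ∞]` and conditional laws on `[0, ∞]`. -/
theorem integral_laplaceQuotient_eq (ρ : Measure Y) [IsFiniteMeasure ρ] {t : Y → I}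
    (ht : Measurable t) {s : Y → ℝ} (hs : Measurable s) (hs0 : ∀ y, 0 ≤ s y) {a : ℝ}
    (hsa : ∀ y, s y ≤ a) :
    ∫ y, laplaceQuotient (s y) (t y) ∂ρ = ∫ y in t ⁻¹' {1}, s y ∂ρ +
      ∫ y, (1 - Real.exp (-((ofUnit (t y)).1 * s y))) ∂(jumpPart ρ t) := by
  have hint : Integrable (fun y => laplaceQuotient (s y) (t y)) ρ := by
    refine Integrable.of_bound
      (measurable_laplaceQuotient.comp (hs.prodMk ht)).aestronglyMeasurable a
      (Eventually.of_forall fun y => ?_)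
    have := laplaceQuotient_mem_Icc (hs0 y) (t y)
    rw [Real.norm_eq_abs, abs_of_nonneg this.1]
    exact this.2.trans (hsa y)
  have hm1 : MeasurableSet (t ⁻¹' {1}) := ht (measurableSet_singleton 1)
  have hm2 : MeasurableSet (t ⁻¹' Ioo 0 1) := ht measurableSet_Ioo
  have hunion : ∫ y, laplaceQuotient (s y) (t y) ∂ρ =
      ∫ y in t ⁻¹' {1} ∪ t ⁻¹' Ioo 0 1, laplaceQuotient (s y) (t y) ∂ρ := by
    rw [setIntegral_eq_integral_of_forall_compl_eq_zero]
    intro y hy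
    have h0 : t y = 0 := by
      by_contra h
      refine hy ?_
      rcases eq_or_lt_of_le (show t y ≤ 1 from (t y).2.2) with h1 | h1
      · exact Or.inl h1
      · exact Or.inr ⟨lt_of_le_of_ne (t y).2.1 (Ne.symm h), h1⟩
    rw [h0, laplaceQuotient_zero]
  rw [hunion, setIntegral_union ?_ hm2 hint.integrableOn hint.integrableOn, integral_jumpPart ρ ht]
  · congr 1
    · refine setIntegral_congr_fun hm1 fun y hy => ?_
      simp only [show t y = 1 from hy, laplaceQuotient_one]
    · exact setIntegral_congr_fun hm2 fun y hy => laplaceQuotient_of_mem_Ioo hy.1 hy.2 _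
  · refine Set.disjoint_left.2 fun y hy hy' => ?_
    exact hy'.2.ne hy

end Splitting

section Evaluation

variable {E : Type*} [MeasurableSpace E]

theorem integrable_of_mem_BPlus {f : E → ℝ} (hf : f ∈ BPlus E) (μ : Measure E)
    [IsFiniteMeasure μ] : Integrable f μ := by
  obtain ⟨hm, h0, C, hC⟩ := hf
  exact Integrable.of_bound hm.aestronglyMeasurable C (Eventually.of_forall fun x => by
    rw [Real.norm_eq_abs, abs_of_nonneg (h0 x)]; exact hC x)

theorem mem_BPlus_of_mem_BPlusLE {f : E → ℝ} {a : ℝ} (hf : f ∈ BPlusLE E a) : f ∈ BPlus E :=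
  ⟨hf.1, hf.2.1, a, hf.2.2⟩

theorem exists_mem_BPlusLE {f : E → ℝ} (hf : f ∈ BPlus E) : ∃ a : ℝ, 0 ≤ a ∧ f ∈ BPlusLE E a := by
  obtain ⟨hm, h0, C, hC⟩ := hf
  exact ⟨max C 0, le_max_right _ _, hm, h0, fun x => (hC x).trans (le_max_left _ _)⟩

theorem integral_mem_Icc {f : E → ℝ} {a : ℝ} (hf : f ∈ BPlusLE E a) (π : ProbabilityMeasure E) :
    ∫ y, f y ∂(π : Measure E) ∈ Icc 0 a := by
  refine ⟨integral_nonneg hf.2.1, ?_⟩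
  simpa using integral_mono (integrable_of_mem_BPlus (mem_BPlus_of_mem_BPlusLE hf) π)
    (integrable_const a) hf.2.2

theorem measurable_integral_measure {α : Type*} [MeasurableSpace α] {μ : α → Measure E}
    (hμ : Measurable μ) {f : E → ℝ} (hf : Measurable f) (hf0 : ∀ y, 0 ≤ f y) :
    Measurable fun a => ∫ y, f y ∂(μ a) := by
  simp_rw [fun a => integral_eq_lintegral_of_nonneg_ae (μ := μ a) (Eventually.of_forall hf0)
    hf.aestronglyMeasurable]
  exact ((Measure.measurable_lintegral hf.ennreal_ofReal).comp hμ).ennreal_toReal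

theorem measurable_integral_probabilityMeasure {f : E → ℝ} (hf : f ∈ BPlus E) :
    Measurable fun π : ProbabilityMeasure E => ∫ y, f y ∂(π : Measure E) :=
  measurable_integral_measure measurable_subtype_coe hf.1 hf.2.1

theorem measurable_integral_finiteMeasure {f : E → ℝ} (hf : f ∈ BPlus E) :
    Measurable fun ν : FiniteMeasure E => ∫ y, f y ∂(ν : Measure E) :=
  measurable_integral_measure measurable_subtype_coe hf.1 hf.2.1

theorem measurable_mass : Measurable fun ν : FiniteMeasure E => (ν.mass : ℝ≥0∞) := by
  simp_rw [FiniteMeasure.ennreal_mass]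
  exact (Measure.measurable_coe MeasurableSet.univ).comp measurable_subtype_coe

theorem measurable_nonzero_mass :
    Measurable fun ν : NonzeroFiniteMeasure E => (ν.1.mass : ℝ≥0∞) :=
  measurable_mass.comp measurable_subtype_coe

end Evaluation

end NonlocalBranching
-- Measurability of the representing kernels, and the passage from joint laws to (B).
namespace NonlocalBranching

open unitInterval

theorem measurable_withDensity {α β : Type*} [MeasurableSpace α] [MeasurableSpace β]
    {μ : α → Measure β} (hμ : Measurable μ) {g : β → ℝ≥0∞} (hg : Measurable g) :
    Measurable fun a => (μ a).withDensity g := by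
  refine Measure.measurable_of_measurable_coe _ fun s hs => ?_
  simp_rw [withDensity_apply _ hs, ← lintegral_indicator hs]
  exact (Measure.measurable_lintegral (hg.indicator hs)).comp hμ

variable {E : Type*} [MeasurableSpace E]

theorem NonzeroFiniteMeasure.mass_pos (ν : NonzeroFiniteMeasure E) : 0 < (ν.1.mass : ℝ) := by
  have := ν.1.mass_nonzero_iff.2 ν.2
  positivity

theorem integral_finiteMeasure_mem_Icc {f : E → ℝ} {a : ℝ} (hf : f ∈ BPlusLE E a)
    (ν : FiniteMeasure E) : ∫ y, f y ∂(ν : Measure E) ∈ Icc 0 (a * ν.mass) := by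
  refine ⟨integral_nonneg hf.2.1, ?_⟩
  have := integral_mono (integrable_of_mem_BPlus (mem_BPlus_of_mem_BPlusLE hf) (ν : Measure E))
    (integrable_const a) hf.2.2
  simpa [mul_comm, FiniteMeasure.mass] using this

theorem integral_const_finiteMeasure (c : ℝ) (ν : FiniteMeasure E) :
    ∫ _, c ∂(ν : Measure E) = c * ν.mass := by
  simp [mul_comm, FiniteMeasure.mass]

theorem const_mem_BPlus {c : ℝ} (hc : 0 ≤ c) : (fun _ => c) ∈ BPlus E :=
  ⟨measurable_const, fun _ => hc, c, fun _ => le_rfl⟩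

theorem add_mem_BPlus {f g : E → ℝ} (hf : f ∈ BPlus E) (hg : g ∈ BPlus E) :
    (fun x => f x + g x) ∈ BPlus E := by
  obtain ⟨hfm, hf0, C, hC⟩ := hf
  obtain ⟨hgm, hg0, D, hD⟩ := hg
  exact ⟨hfm.add hgm, fun x => add_nonneg (hf0 x) (hg0 x), C + D, fun x => add_le_add (hC x) (hD x)⟩

theorem indicator_mem_BPlus {s : Set E} (hs : MeasurableSet s) :
    (s.indicator fun _ => (1 : ℝ)) ∈ BPlus E :=
  ⟨measurable_const.indicator hs, fun x => indicator_nonneg (fun _ _ => zero_le_one) x, 1,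
    fun x => indicator_le_self' (fun _ _ => zero_le_one) x⟩

theorem measurable_integral_nonzeroFiniteMeasure {f : E → ℝ} (hf : f ∈ BPlus E) :
    Measurable fun ν : NonzeroFiniteMeasure E => ∫ y, f y ∂(ν.1 : Measure E) :=
  (measurable_integral_finiteMeasure hf).comp measurable_subtype_coe

theorem one_sub_exp_neg_mem_Icc {x : ℝ} (hx : 0 ≤ x) : 1 - Real.exp (-x) ∈ Icc 0 x :=
  ⟨by linarith [Real.exp_le_one_iff.2 (neg_nonpos.2 hx)], by linarith [Real.add_one_le_exp (-x)]⟩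

theorem integrable_one_sub_exp {Γ : Measure (NonzeroFiniteMeasure E)}
    (hΓ : ∫⁻ ν, (ν.1.mass : ℝ≥0∞) ∂Γ ≠ ∞) {f : E → ℝ} (hf : f ∈ BPlus E) :
    Integrable (fun ν : NonzeroFiniteMeasure E => 1 - Real.exp (-∫ y, f y ∂(ν.1 : Measure E))) Γ := by
  obtain ⟨a, ha, hfa⟩ := exists_mem_BPlusLE hf
  have hm : Integrable (fun ν : NonzeroFiniteMeasure E => (ν.1.mass : ℝ)) Γ := by
    have := integrable_toReal_of_lintegral_ne_top measurable_nonzero_mass.aemeasurable hΓ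
    exact this
  refine (hm.const_mul a).mono'
    (measurable_const.sub (measurable_integral_nonzeroFiniteMeasure hf).neg.exp).aestronglyMeasurable
    (Eventually.of_forall fun ν => ?_)
  have h := integral_finiteMeasure_mem_Icc hfa ν.1
  have h2 := one_sub_exp_neg_mem_Icc h.1
  rw [Real.norm_eq_abs, abs_of_nonneg h2.1]
  exact h2.2.trans h.2

/-- The Laplace functionals generate the σ-algebra of the space of nonzero finite measures. -/
theorem measurableSpace_le_generateFrom_laplace :
    (inferInstance : MeasurableSpace (NonzeroFiniteMeasure E)) ≤ MeasurableSpace.generateFrom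
      {s | ∃ F ∈ {F : NonzeroFiniteMeasure E → ℝ | ∃ f ∈ BPlus E,
        F = fun ν => Real.exp (-∫ y, f y ∂(ν.1 : Measure E))}, ∃ t : ℝ, s = {ν | t < F ν}} := by
  set m' := MeasurableSpace.generateFrom
      {s | ∃ F ∈ {F : NonzeroFiniteMeasure E → ℝ | ∃ f ∈ BPlus E,
        F = fun ν => Real.exp (-∫ y, f y ∂(ν.1 : Measure E))}, ∃ t : ℝ, s = {ν | t < F ν}} with hm'
  have key : Measurable[m'] fun ν : NonzeroFiniteMeasure E => (ν.1 : Measure E) := by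
    refine @Measure.measurable_of_measurable_coe E (NonzeroFiniteMeasure E) _ m' _ fun s hs => ?_
    have h1 : Measurable[m'] fun ν : NonzeroFiniteMeasure E =>
        Real.exp (-∫ y, s.indicator (fun _ => (1 : ℝ)) y ∂(ν.1 : Measure E)) := by
      refine @measurable_of_Ioi ℝ (NonzeroFiniteMeasure E) _ _ _ m' _ _ _ _ fun t => ?_
      exact MeasurableSpace.measurableSet_generateFrom
        ⟨_, ⟨_, indicator_mem_BPlus hs, rfl⟩, t, rfl⟩
    have h2 : Measurable[m'] fun ν : NonzeroFiniteMeasure E => ENNReal.ofReal (-Real.log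
        (Real.exp (-∫ y, s.indicator (fun _ => (1 : ℝ)) y ∂(ν.1 : Measure E)))) :=
      ENNReal.measurable_ofReal.comp (measurable_neg.comp (Real.measurable_log.comp h1))
    convert h2 using 2 with ν
    rw [Real.log_exp, neg_neg, integral_indicator_const _ hs, smul_eq_mul, mul_one, Measure.real,
      ENNReal.ofReal_toReal (measure_ne_top _ _)]
  exact (MeasurableSpace.comap_comp (f := Subtype.val) (g := Subtype.val)).trans_le key.comap_le

/-- Kernel measurability of `lam` and `Γ` follows from measurability of the functionals
they represent. -/
theorem MeasureRep.of_measurable {lam : E → Measure E} {Γ : E → Measure (NonzeroFiniteMeasure E)}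
    {ζ : E → (E → ℝ) → ℝ}
    (hmass : ∀ x, lam x univ + ∫⁻ ν, (ν.1.mass : ℝ≥0∞) ∂(Γ x) ≤ 1)
    (hrep : ∀ x, ∀ f ∈ BPlus E, ζ x f = (∫ y, f y ∂(lam x)) +
      ∫ ν, (1 - Real.exp (-∫ y, f y ∂(ν.1 : Measure E))) ∂(Γ x))
    (hζ : ∀ f ∈ BPlus E, Measurable fun x => ζ x f) : MeasureRep lam Γ ζ := by
  have hlam1 : ∀ x, lam x univ ≤ 1 := fun x => le_self_add.trans (hmass x)
  have hΓ1 : ∀ x, ∫⁻ ν, (ν.1.mass : ℝ≥0∞) ∂(Γ x) ≤ 1 := fun x => le_add_self.trans (hmass x)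
  have hlamfin : ∀ x, IsFiniteMeasure (lam x) := fun x => ⟨(hlam1 x).trans_lt ENNReal.one_lt_top⟩
  have hΓfin : ∀ x, ∫⁻ ν, (ν.1.mass : ℝ≥0∞) ∂(Γ x) ≠ ∞ := fun x =>
    ((hΓ1 x).trans_lt ENNReal.one_lt_top).ne
  have hint : ∀ x, ∀ f ∈ BPlus E, Integrable
      (fun ν : NonzeroFiniteMeasure E => 1 - Real.exp (-∫ y, f y ∂(ν.1 : Measure E))) (Γ x) :=
    fun x f hf => integrable_one_sub_exp (hΓfin x) hf
  set g : NonzeroFiniteMeasure E → ℝ := fun ν => 1 - Real.exp (-∫ _, (1 : ℝ) ∂(ν.1 : Measure E))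
    with hg
  have hgpos : ∀ ν, 0 < g ν := fun ν => by
    simp only [hg, integral_const_finiteMeasure, one_mul, sub_pos, Real.exp_lt_one_iff,
      neg_lt_zero]
    exact ν.mass_pos
  have h1 : (fun _ => (1 : ℝ)) ∈ BPlus E := const_mem_BPlus zero_le_one
  have hgm : Measurable g :=
    measurable_const.sub (measurable_integral_nonzeroFiniteMeasure h1).neg.exp
  have hgm' : Measurable fun ν => ENNReal.ofReal (g ν) := hgm.ennreal_ofReal
  -- `Γ x` may be infinite near the zero measure, whereas weighting by `g(ν) = 1 - exp(-ν(1))` makes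
  -- it finite. Since `g > 0`, `Γ` is recovered from `Q` by the density `1 / g`.
  set Q : E → Measure (NonzeroFiniteMeasure E) := fun x =>
    (Γ x).withDensity fun ν => ENNReal.ofReal (g ν) with hQ
  have hQfin : ∀ x, IsFiniteMeasure (Q x) := fun x => by
    refine isFiniteMeasure_withDensity (ne_top_of_le_ne_top (hΓfin x) (lintegral_mono fun ν => ?_))
    have := (one_sub_exp_neg_mem_Icc (x := ∫ _, (1 : ℝ) ∂(ν.1 : Measure E))
      (integral_nonneg fun _ => zero_le_one)).2
    refine (ENNReal.ofReal_le_ofReal this).trans_eq ?_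
    rw [integral_const_finiteMeasure, one_mul, ENNReal.ofReal_coe_nnreal]
  have hlapm : ∀ f ∈ BPlus E, Measurable fun ν : NonzeroFiniteMeasure E =>
      Real.exp (-∫ y, f y ∂(ν.1 : Measure E)) := fun f hf =>
    (measurable_integral_nonzeroFiniteMeasure hf).neg.exp
  have hlapb : ∀ f ∈ BPlus E, ∀ ν : NonzeroFiniteMeasure E,
      |Real.exp (-∫ y, f y ∂(ν.1 : Measure E))| ≤ 1 := fun f hf ν => by
    rw [abs_of_pos (Real.exp_pos _), Real.exp_le_one_iff, neg_nonpos]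
    exact integral_nonneg hf.2.1
  -- Replacing `f` by `f + 1` multiplies `exp(-ν(f))` by `exp(-ν(1))`, so the increment of `ζ` is
  -- the Laplace functional of `Q` plus the constant `lam(x, 1)`.
  have hdiff : ∀ x, ∀ f ∈ BPlus E, ζ x (fun y => f y + 1) - ζ x f = (lam x).real univ +
      ∫ ν, Real.exp (-∫ y, f y ∂(ν.1 : Measure E)) ∂(Q x) := by
    intro x f hf
    have hf1 := add_mem_BPlus hf h1
    have e1 : ∫ ν, Real.exp (-∫ y, f y ∂(ν.1 : Measure E)) ∂(Q x) =
        ∫ ν, (1 - Real.exp (-∫ y, (f y + 1) ∂(ν.1 : Measure E))) ∂(Γ x) -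
        ∫ ν, (1 - Real.exp (-∫ y, f y ∂(ν.1 : Measure E))) ∂(Γ x) := by
      rw [← integral_sub (hint x _ hf1) (hint x _ hf), hQ,
        integral_withDensity_eq_integral_toReal_smul hgm' (by simp)]
      refine integral_congr_ae (Eventually.of_forall fun ν => ?_)
      simp only [smul_eq_mul]
      rw [ENNReal.toReal_ofReal (hgpos ν).le, integral_add (integrable_of_mem_BPlus hf _) (integrable_const _), neg_add, Real.exp_add]
      simp only [hg]
      ring
    rw [hrep x _ hf1, hrep x _ hf, e1, integral_add (integrable_of_mem_BPlus hf _)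
      (integrable_const _)]
    simp
    ring
  -- Along the constants `f = n` the Laplace functional of `Q` dies out, because `Q` lives on
  -- nonzero measures; this isolates `lam(x, 1)`.
  have hlim : ∀ x, Tendsto (fun n : ℕ => ζ x (fun _ => (n : ℝ) + 1) - ζ x fun _ => (n : ℝ)) atTop
      (𝓝 ((lam x).real univ)) := by
    intro x
    have h0 : Tendsto (fun n : ℕ => ∫ ν, Real.exp (-∫ _, (n : ℝ) ∂(ν.1 : Measure E)) ∂(Q x)) atTop
        (𝓝 (∫ _, (0 : ℝ) ∂(Q x))) := by
      refine tendsto_integral_of_dominated_convergence (fun _ => 1)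
        (fun n => (hlapm _ (const_mem_BPlus n.cast_nonneg)).aestronglyMeasurable)
        (integrable_const 1)
        (fun n => Eventually.of_forall (hlapb _ (const_mem_BPlus n.cast_nonneg)))
        (Eventually.of_forall fun ν => ?_)
      simp_rw [integral_const_finiteMeasure]
      exact Real.tendsto_exp_neg_atTop_nhds_zero.comp
        (tendsto_natCast_atTop_atTop.atTop_mul_const ν.mass_pos)
    have := h0.const_add ((lam x).real univ)
    rw [integral_zero, add_zero] at this
    exact this.congr fun n => (hdiff x _ (const_mem_BPlus n.cast_nonneg)).symm
  have hmassm : Measurable fun x => (lam x).real univ := by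
    refine measurable_of_tendsto_metrizable (fun n : ℕ => ?_) (tendsto_pi_nhds.2 hlim)
    exact (hζ _ (const_mem_BPlus (by positivity))).sub (hζ _ (const_mem_BPlus (by positivity)))
  have hQm : Measurable Q := by
    refine measurable_measure_of_multiplicative (C := {F | ∃ f ∈ BPlus E,
      F = fun ν => Real.exp (-∫ y, f y ∂(ν.1 : Measure E))})
      ⟨fun _ => 0, const_mem_BPlus le_rfl, by simp⟩ ?_ ?_ ?_ measurableSpace_le_generateFrom_laplace ?_
    · rintro _ ⟨f, hf, rfl⟩
      exact ⟨1, hlapb f hf⟩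
    · rintro _ ⟨f₁, hf₁, rfl⟩ _ ⟨f₂, hf₂, rfl⟩
      refine ⟨_, add_mem_BPlus hf₁ hf₂, ?_⟩
      funext ν
      rw [integral_add (integrable_of_mem_BPlus hf₁ _) (integrable_of_mem_BPlus hf₂ _), neg_add,
        Real.exp_add]
    · rintro _ ⟨f, hf, rfl⟩
      exact hlapm f hf
    · rintro _ ⟨f, hf, rfl⟩
      have : Measurable fun x => ζ x (fun y => f y + 1) - ζ x f - (lam x).real univ :=
        ((hζ _ (add_mem_BPlus hf h1)).sub (hζ _ hf)).sub hmassm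
      convert this using 2 with x
      rw [hdiff x f hf]
      ring
  have hΓm : Measurable Γ := by
    have : Γ = fun x => (Q x).withDensity fun ν => (ENNReal.ofReal (g ν))⁻¹ := by
      funext x
      exact (withDensity_inv_same hgm' (Eventually.of_forall fun ν => by simpa using hgpos ν)
        (Eventually.of_forall fun ν => ENNReal.ofReal_ne_top)).symm
    rw [this]
    exact measurable_withDensity hQm hgm'.inv
  refine ⟨⟨?_, 1, by simpa using hlam1⟩, ⟨measurable_withDensity hΓm measurable_nonzero_mass, 1,
    fun x => ?_⟩, hmass, hrep⟩
  · refine Measure.measurable_of_measurable_coe _ fun s hs => ?_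
    have hsf := indicator_mem_BPlus hs
    have : Measurable fun x => ENNReal.ofReal (ζ x (s.indicator fun _ => (1 : ℝ)) -
        ∫ ν, (1 - Real.exp (-∫ y, s.indicator (fun _ => (1 : ℝ)) y ∂(ν.1 : Measure E))) ∂(Γ x)) := by
      refine ((hζ _ hsf).sub (measurable_integral_measure hΓm
        (measurable_const.sub (hlapm _ hsf)) fun ν => ?_)).ennreal_ofReal
      exact (one_sub_exp_neg_mem_Icc (integral_nonneg hsf.2.1)).1
    convert this using 2 with x
    rw [hrep x _ hsf, add_sub_cancel_right, integral_indicator_const _ hs, smul_eq_mul, mul_one,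
      Measure.real, ENNReal.ofReal_toReal (measure_ne_top _ _)]
  · rw [withDensity_apply _ MeasurableSet.univ, setLIntegral_univ]
    exact_mod_cast hΓ1 x

/-- The measure `u π`. -/
noncomputable def scaleMeasure (π : ProbabilityMeasure E) (u : PosReal) : NonzeroFiniteMeasure E :=
  ⟨⟨ENNReal.ofReal u.1 • (π : Measure E), 
    Measure.smul_finite _ ENNReal.ofReal_ne_top⟩, fun h => by
    have h2 := congrArg (fun ν : FiniteMeasure E => (ν : Measure E) univ) h
    simp only [FiniteMeasure.toMeasure_mk, FiniteMeasure.toMeasure_zero, Measure.smul_apply,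
      measure_univ, smul_eq_mul, mul_one, Measure.coe_zero, Pi.zero_apply] at h2
    exact (ENNReal.ofReal_pos.2 u.2).ne' h2⟩

theorem coe_scaleMeasure (π : ProbabilityMeasure E) (u : PosReal) :
    ((scaleMeasure π u).1 : Measure E) = ENNReal.ofReal u.1 • (π : Measure E) := rfl

theorem integral_scaleMeasure (π : ProbabilityMeasure E) (u : PosReal) (f : E → ℝ) :
    ∫ y, f y ∂((scaleMeasure π u).1 : Measure E) = u.1 * ∫ y, f y ∂(π : Measure E) := by
  rw [coe_scaleMeasure, integral_smul_measure, ENNReal.toReal_ofReal u.2.le, smul_eq_mul]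

theorem mass_scaleMeasure (π : ProbabilityMeasure E) (u : PosReal) :
    ((scaleMeasure π u).1.mass : ℝ≥0∞) = ENNReal.ofReal u.1 := by
  rw [FiniteMeasure.ennreal_mass, coe_scaleMeasure]
  simp

theorem measurable_scaleMeasure :
    Measurable fun p : ProbabilityMeasure E × PosReal => scaleMeasure p.1 p.2 := by
  refine Measurable.subtype_mk (Measurable.subtype_mk ?_)
  refine Measure.measurable_of_measurable_coe _ fun s hs => ?_
  simp only [Measure.smul_apply, smul_eq_mul]
  exact (measurable_subtype_coe.comp measurable_snd).ennreal_ofReal.mul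
    ((Measure.measurable_coe hs).comp (measurable_subtype_coe.comp measurable_fst))

/-- Every probability measure on `M₀(E) × [0, ∞]` yields a drift measure and a jump measure. -/
theorem exists_measures_of_joint (ρ : Measure (ProbabilityMeasure E × I))
    [IsProbabilityMeasure ρ] :
    ∃ (lam : Measure E) (Γ : Measure (NonzeroFiniteMeasure E)),
      lam univ + ∫⁻ ν, (ν.1.mass : ℝ≥0∞) ∂Γ ≤ 1 ∧ ∀ f ∈ BPlus E,
        ∫ p, laplaceQuotient (∫ y, f y ∂(p.1 : Measure E)) p.2 ∂ρ = (∫ y, f y ∂lam) +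
          ∫ ν, (1 - Real.exp (-∫ y, f y ∂(ν.1 : Measure E))) ∂Γ := by
  have hcoe : Measurable fun p : ProbabilityMeasure E × I => (p.1 : Measure E) :=
    measurable_subtype_coe.comp measurable_fst
  have hsc : Measurable fun p : ProbabilityMeasure E × I => scaleMeasure p.1 (ofUnit p.2) :=
    measurable_scaleMeasure.comp (measurable_fst.prodMk (measurable_ofUnit.comp measurable_snd))
  have hlint : ∀ g : E → ℝ≥0∞, Measurable g →
      ∫⁻ y, g y ∂((ρ.restrict (Prod.snd ⁻¹' {1})).bind fun p => (p.1 : Measure E)) =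
        ∫⁻ p in Prod.snd ⁻¹' {1}, (∫⁻ y, g y ∂(p.1 : Measure E)) ∂ρ := fun g hg =>
    Measure.lintegral_bind hcoe.aemeasurable hg.aemeasurable
  -- `lam` averages `π` over the part `u = 0`, and `Γ` is the image of the jump part under `(π, u) ↦
  -- u π`. The mass bound is the total mass of `ρ` off `u = ∞`.
  refine ⟨(ρ.restrict (Prod.snd ⁻¹' {1})).bind fun p => (p.1 : Measure E),
    (jumpPart ρ Prod.snd).map fun p => scaleMeasure p.1 (ofUnit p.2), ?_, fun f hf => ?_⟩
  · rw [lintegral_map measurable_nonzero_mass hsc]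
    simp_rw [mass_scaleMeasure]
    rw [← setLIntegral_univ, ← withDensity_apply _ MeasurableSet.univ,
      withDensity_jumpPart ρ measurable_snd, ← lintegral_one, hlint _ measurable_const]
    simp only [lintegral_const, measure_univ, one_mul, Measure.restrict_apply_univ, mul_one]
    rw [← measure_union _ (measurable_snd measurableSet_Ioo)]
    · exact prob_le_one
    · exact Set.disjoint_left.2 fun p hp hp' => hp'.2.ne hp
  · obtain ⟨a, ha, hfa⟩ := exists_mem_BPlusLE hf
    rw [integral_laplaceQuotient_eq ρ measurable_snd
      (s := fun p => ∫ y, f y ∂(p.1 : Measure E))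
      ((measurable_integral_probabilityMeasure hf).comp measurable_fst)
      (fun p => (integral_mem_Icc hfa p.1).1) fun p => (integral_mem_Icc hfa p.1).2]
    have hsm : Measurable fun p : ProbabilityMeasure E × I => ∫ y, f y ∂(p.1 : Measure E) :=
      (measurable_integral_probabilityMeasure hf).comp measurable_fst
    have hlm : Measurable fun ν : NonzeroFiniteMeasure E =>
        1 - Real.exp (-∫ y, f y ∂(ν.1 : Measure E)) :=
      measurable_const.sub (measurable_integral_nonzeroFiniteMeasure hf).neg.exp
    congr 1
    · rw [integral_eq_lintegral_of_nonneg_ae (Eventually.of_forall fun p : ProbabilityMeasure E × I =>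
          (integral_mem_Icc hfa p.1).1) hsm.aestronglyMeasurable,
        integral_eq_lintegral_of_nonneg_ae (Eventually.of_forall hf.2.1)
          hf.1.aestronglyMeasurable, hlint _ hf.1.ennreal_ofReal]
      congr 2
      funext p
      rw [ofReal_integral_eq_lintegral_ofReal (integrable_of_mem_BPlus hf _)
        (Eventually.of_forall hf.2.1)]
    · rw [integral_map hsc.aemeasurable hlm.aestronglyMeasurable]
      simp_rw [integral_scaleMeasure]

end NonlocalBranching
-- From particle forms to the representation (B).
namespace NonlocalBranching

open unitInterval

variable {E : Type*} [MeasurableSpace E]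

namespace IsOffspringLaw

variable {q : ℕ → E → ProbabilityMeasure E → ℝ}

theorem tsum_ofReal (h : IsOffspringLaw q) (x : E) (π : ProbabilityMeasure E) :
    ∑' i, ENNReal.ofReal (q i x π) = 1 := by
  rw [← ENNReal.ofReal_tsum_of_nonneg (fun i => h.nonneg i x π) (h.hasSum_one x π).summable,
    (h.hasSum_one x π).tsum_eq, ENNReal.ofReal_one]

/-- The functions `i ↦ zⁱ`, `z ∈ [0, 1]`, form a multiplicative class on `ℕ`, and `i ↦ 2⁻ⁱ` alone
separates points. So the law on `ℕ` depends measurably on `(x, π)` as soon as its generating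
function does. -/
theorem measurable_coeff (h : IsOffspringLaw q) (i : ℕ) :
    Measurable fun p : E × ProbabilityMeasure E => q i p.1 p.2 := by
  set μ : E × ProbabilityMeasure E → Measure ℕ := fun p =>
    Measure.sum fun i => ENNReal.ofReal (q i p.1 p.2) • Measure.dirac i with hμ
  have hfin : ∀ p, IsFiniteMeasure (μ p) := fun p => ⟨by
    simp only [hμ, Measure.sum_apply _ MeasurableSet.univ, Measure.smul_apply, measure_univ,
      smul_eq_mul, mul_one, h.tsum_ofReal]
    exact ENNReal.one_lt_top⟩
  have hpt : ∀ p i, μ p {i} = ENNReal.ofReal (q i p.1 p.2) := fun p i => by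
    simp only [hμ, Measure.sum_apply _ (measurableSet_singleton i), Measure.smul_apply,
      Measure.dirac_apply' _ (measurableSet_singleton i), smul_eq_mul]
    rw [tsum_eq_single i fun j hj => by simp [hj]]
    simp
  have hmeas : Measurable μ := by
    refine measurable_measure_of_multiplicative
      (C := range fun (z : Icc (0 : ℝ) 1) (i : ℕ) => (z : ℝ) ^ i) ⟨1, by simp⟩ ?_ ?_ ?_ ?_ ?_
    · rintro _ ⟨z, rfl⟩
      exact ⟨1, fun i => by
        rw [abs_of_nonneg (pow_nonneg z.2.1 _)]; exact pow_le_one₀ z.2.1 z.2.2⟩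
    · rintro _ ⟨z, rfl⟩ _ ⟨w, rfl⟩
      exact ⟨⟨z * w, mul_nonneg z.2.1 w.2.1, mul_le_one₀ z.2.2 w.2.1 w.2.2⟩, by
        funext i; simp [mul_pow]⟩
    · rintro _ ⟨z, rfl⟩
      exact measurable_of_countable _
    · set m' := MeasurableSpace.generateFrom {s | ∃ f ∈ range fun (z : Icc (0 : ℝ) 1) (i : ℕ) =>
        (z : ℝ) ^ i, ∃ t : ℝ, s = {x | t < f x}} with hm'
      have hf : Measurable[m'] fun i : ℕ => (1 / 2 : ℝ) ^ i := by
        refine @measurable_of_Ioi ℝ ℕ _ _ _ m' _ _ _ _ fun t => ?_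
        exact MeasurableSpace.measurableSet_generateFrom
          ⟨_, ⟨⟨1 / 2, by norm_num, by norm_num⟩, rfl⟩, t, rfl⟩
      have hpre : ∀ n : ℕ, {n} = (fun i : ℕ => (1 / 2 : ℝ) ^ i) ⁻¹' {(1 / 2 : ℝ) ^ n} := fun n => by
        ext i
        exact (pow_right_injective₀ (a := (1 / 2 : ℝ)) (by norm_num) (by norm_num)).eq_iff.symm
      have hsing : ∀ n : ℕ, MeasurableSet[m'] {n} := fun n => by
        rw [hpre n]
        exact hf (measurableSet_singleton _)
      intro s _
      rw [← biUnion_of_singleton s]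
      exact MeasurableSet.biUnion s.to_countable fun n _ => hsing n
    · rintro _ ⟨z, rfl⟩
      have h1 : Measurable fun p : E × ProbabilityMeasure E => genFun q p.1 p.2 z :=
        h.measurable_genFun.comp (measurable_fst.prodMk (measurable_snd.prodMk measurable_const))
      convert h1 using 2 with p
      rw [integral_countable]
      · simp only [Measure.real, hpt, ENNReal.toReal_ofReal (h.nonneg _ _ _), smul_eq_mul, genFun]
      · exact Integrable.of_bound (measurable_of_countable _).aestronglyMeasurable 1
          (Eventually.of_forall fun i => by
            rw [Real.norm_eq_abs, abs_of_nonneg (pow_nonneg z.2.1 _)]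
            exact pow_le_one₀ z.2.1 z.2.2)
  have h2 := ((Measure.measurable_coe (measurableSet_singleton i)).comp hmeas).ennreal_toReal
  convert h2 using 2 with p
  simp only [Function.comp, hpt, ENNReal.toReal_ofReal (h.nonneg _ _ _)]

theorem summable_mul_pow (h : IsOffspringLaw q) (x : E) (π : ProbabilityMeasure E) {z : ℝ}
    (hz : z ∈ Icc (0 : ℝ) 1) : Summable fun i => q i x π * z ^ i :=
  (h.hasSum_one x π).summable.of_nonneg_of_le
    (fun i => mul_nonneg (h.nonneg i x π) (pow_nonneg hz.1 _))
    fun i => mul_le_of_le_one_right (h.nonneg i x π) (pow_le_one₀ hz.1 hz.2)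

theorem hasSum_one_sub_genFun (h : IsOffspringLaw q) (x : E) (π : ProbabilityMeasure E) {z : ℝ}
    (hz : z ∈ Icc (0 : ℝ) 1) :
    HasSum (fun i => q (i + 1) x π * (1 - z ^ (i + 1))) (1 - genFun q x π z) := by
  have h1 := (h.hasSum_one x π).sub (h.summable_mul_pow x π hz).hasSum
  have h2 := (hasSum_nat_add_iff' 1).2 h1
  simp only [Finset.range_one, Finset.sum_singleton, pow_zero, mul_one, sub_self, sub_zero] at h2
  refine h2.congr_fun fun i => ?_
  ring

theorem genFun_mem_Icc (h : IsOffspringLaw q) (x : E) (π : ProbabilityMeasure E) {z : ℝ}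
    (hz : z ∈ Icc (0 : ℝ) 1) : genFun q x π z ∈ Icc 0 1 := by
  refine ⟨tsum_nonneg fun i => mul_nonneg (h.nonneg i x π) (pow_nonneg hz.1 _), ?_⟩
  have := (h.hasSum_one_sub_genFun x π hz).nonneg fun i =>
    mul_nonneg (h.nonneg _ x π) (sub_nonneg.2 (pow_le_one₀ hz.1 hz.2))
  linarith

theorem measurable_genFun_comp (h : IsOffspringLaw q) {g : ProbabilityMeasure E → ℝ}
    (hg : Measurable g) (hg01 : ∀ π, g π ∈ Icc (0 : ℝ) 1) :
    Measurable fun p : E × ProbabilityMeasure E => genFun q p.1 p.2 (g p.2) :=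
  h.measurable_genFun.comp (measurable_fst.prodMk
    (measurable_snd.prodMk ((hg.comp measurable_snd).subtype_mk (h := fun p => hg01 p.2))))

end IsOffspringLaw

theorem one_sub_div_mem_Icc {s k : ℝ} (hk : 0 < k) (hs : 0 ≤ s) (hsk : s ≤ k) :
    1 - s / k ∈ Icc (0 : ℝ) 1 := by
  have h1 : s / k ≤ 1 := (div_le_one hk).2 hsk
  have h2 : 0 ≤ s / k := by positivity
  exact ⟨by linarith, by linarith⟩

theorem measurable_particle_integrand {q : ℕ → E → ProbabilityMeasure E → ℝ}
    (h : IsOffspringLaw q) {k : ℕ} (hk : 0 < k) {f : E → ℝ} {a : ℝ} (hf : f ∈ BPlusLE E a)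
    (hak : a ≤ k) : Measurable fun p : E × ProbabilityMeasure E =>
      (k : ℝ) * (1 - genFun q p.1 p.2 (1 - (∫ y, f y ∂(p.2 : Measure E)) / k)) :=
  measurable_const.mul (measurable_const.sub (h.measurable_genFun_comp
    (measurable_const.sub
      ((measurable_integral_probabilityMeasure (mem_BPlus_of_mem_BPlusLE hf)).div_const _))
    fun π => one_sub_div_mem_Icc (by exact_mod_cast hk) (integral_mem_Icc hf π).1
      ((integral_mem_Icc hf π).2.trans hak)))

theorem measurable_particleZeta (G : Kernel E (ProbabilityMeasure E)) [IsMarkovKernel G]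
    {q : ℕ → E → ProbabilityMeasure E → ℝ} (h : IsOffspringLaw q) {k : ℕ} (hk : 0 < k)
    {f : E → ℝ} {a : ℝ} (hf : f ∈ BPlusLE E a) (hak : a ≤ k) :
    Measurable fun x => particleZeta G q k x f :=
  ((measurable_particle_integrand h hk hf hak).stronglyMeasurable.integral_kernel_prod_right
    (f := fun x (π : ProbabilityMeasure E) =>
      (k : ℝ) * (1 - genFun q x π (1 - (∫ y, f y ∂(π : Measure E)) / k)))).measurable

/-- The size-biased offspring law of `i` particles of mass `1 / k`, on the compactified half-line;
the missing mass sits at `u = ∞`. -/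
theorem exists_kernel_sizeBiased {q : ℕ → E → ProbabilityMeasure E → ℝ} (h : IsOffspringLaw q)
    (x : E) (hmean : ∀ π, offspringMean q x π ≤ 1) {k : ℕ} (hk : 0 < k) :
    ∃ κ : Kernel (ProbabilityMeasure E) I, IsMarkovKernel κ ∧
      ∀ (π : ProbabilityMeasure E) (s : ℝ), 0 ≤ s → s ≤ k →
        |(k : ℝ) * (1 - genFun q x π (1 - s / k)) - ∫ t, laplaceQuotient s t ∂(κ π)| ≤ s ^ 2 / k := by
  have hk' : (0 : ℝ) < k := by exact_mod_cast hk
  -- Indices are shifted by one: the event of no offspring contributes nothing to `1 - h` and has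
  -- size-biased weight zero.
  set u : ℕ → PosReal := fun i => ⟨((i + 1 : ℕ) : ℝ) / k, by positivity⟩ with hu
  set w : ℕ → ProbabilityMeasure E → ℝ≥0∞ := fun i π =>
    ((i + 1 : ℕ) : ℝ≥0∞) * ENNReal.ofReal (q (i + 1) x π) with hw
  have hwm : ∀ i, Measurable (w i) := fun i =>
    ((h.measurable_coeff (i + 1)).comp measurable_prodMk_left).ennreal_ofReal.const_mul _
  have hwsum : ∀ π, ∑' i, w i π = offspringMean q x π := fun π => by
    have h0 := tsum_eq_zero_add' (f := fun i : ℕ => (i : ℝ≥0∞) * ENNReal.ofReal (q i x π))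
      ENNReal.summable
    rw [offspringMean, h0]
    simp [hw]
  have hw1 : ∀ π, ∑' i, w i π ≤ 1 := fun π => (hwsum π).trans_le (hmean π)
  set ρ : ProbabilityMeasure E → Measure I := fun π =>
    Measure.sum fun i => w i π • Measure.dirac (toUnit (u i)) with hρ
  set κ : ProbabilityMeasure E → Measure I := fun π =>
    ρ π + (1 - ∑' i, w i π) • Measure.dirac 0 with hκ
  have hρuniv : ∀ π, ρ π univ = ∑' i, w i π := fun π => by
    simp [hρ, Measure.sum_apply _ MeasurableSet.univ]
  have hκp : ∀ π, IsProbabilityMeasure (κ π) := fun π => ⟨by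
    simp [hκ, hρuniv, add_tsub_cancel_of_le (hw1 π)]⟩
  have hκm : Measurable κ := by
    refine Measure.measurable_of_measurable_coe _ fun s hs => ?_
    simp only [hκ, hρ, Measure.add_apply, Measure.sum_apply _ hs, Measure.smul_apply, smul_eq_mul]
    exact (Measurable.tsum fun i => (hwm i).mul_const _).add
      ((measurable_const.sub (Measurable.tsum hwm)).mul_const _)
  refine ⟨⟨κ, hκm⟩, ⟨hκp⟩, fun π s hs hsk => ?_⟩
  have hz := one_sub_div_mem_Icc hk' hs hsk
  have hρfin : IsFiniteMeasure (ρ π) := ⟨(hρuniv π).trans_lt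
    ((hw1 π).trans_lt ENNReal.one_lt_top)⟩
  have hint : ∀ μ : Measure I, IsFiniteMeasure μ → Integrable (laplaceQuotient s) μ := fun μ _ =>
    Integrable.of_bound (continuous_laplaceQuotient hs).aestronglyMeasurable s
      (Eventually.of_forall fun t => by
        have := laplaceQuotient_mem_Icc hs t
        rw [Real.norm_eq_abs, abs_of_nonneg this.1]
        exact this.2)
  have hfin0 : IsFiniteMeasure ((1 - ∑' i, w i π) • Measure.dirac (0 : I)) :=
    Measure.smul_finite _ (ne_top_of_le_ne_top ENNReal.one_ne_top tsub_le_self)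
  have hwreal : ∀ i, (w i π).toReal = ((i + 1 : ℕ) : ℝ) * q (i + 1) x π := fun i => by
    simp only [hw]
    rw [ENNReal.toReal_mul, ENNReal.toReal_natCast, ENNReal.toReal_ofReal (h.nonneg _ _ _)]
  have hsumκ : HasSum (fun i => ((i + 1 : ℕ) : ℝ) * q (i + 1) x π * laplaceQuotient s (toUnit (u i)))
      (∫ t, laplaceQuotient s t ∂(κ π)) := by
    have h1 := hasSum_integral_measure (hint (ρ π) hρfin)
    have h2 : ∫ t, laplaceQuotient s t ∂(κ π) = ∫ t, laplaceQuotient s t ∂(ρ π) := by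
      rw [hκ, integral_add_measure (hint _ hρfin) (hint _ hfin0), integral_smul_measure,
        integral_dirac, laplaceQuotient_zero, smul_zero, add_zero]
    have e : (fun i => ((i + 1 : ℕ) : ℝ) * q (i + 1) x π * laplaceQuotient s (toUnit (u i))) =
        fun i => ∫ t, laplaceQuotient s t ∂(w i π • Measure.dirac (toUnit (u i))) := by
      funext i
      rw [integral_smul_measure, integral_dirac, hwreal, smul_eq_mul]
    rw [h2, e]
    exact h1
  have hsumq := (h.hasSum_one_sub_genFun x π hz).mul_left (k : ℝ)
  have hwtsum : HasSum (fun i => ((i + 1 : ℕ) : ℝ) * q (i + 1) x π) (∑' i, w i π).toReal := by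
    have hne : ∑' i, w i π ≠ ∞ := ne_top_of_le_ne_top ENNReal.one_ne_top (hw1 π)
    have := ENNReal.hasSum_toReal hne
    rw [← ENNReal.tsum_toReal_eq (ENNReal.ne_top_of_tsum_ne_top hne)] at this
    simpa only [hwreal] using this
  -- Each term errs by at most its size-biased weight times `s² / k`, and these weights sum to at
  -- most one.
  have hbound : ∀ i, |(k : ℝ) * (q (i + 1) x π * (1 - (1 - s / k) ^ (i + 1))) -
      ((i + 1 : ℕ) : ℝ) * q (i + 1) x π * laplaceQuotient s (toUnit (u i))| ≤
      ((i + 1 : ℕ) : ℝ) * q (i + 1) x π * (s ^ 2 / k) := fun i => by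
    have h1 := abs_particle_sub_le hk' (Nat.succ_pos i) hs hsk
    have hi : (0 : ℝ) < ((i + 1 : ℕ) : ℝ) := by positivity
    have h2 := h.nonneg (i + 1) x π
    rw [laplaceQuotient_toUnit]
    have h3 : (k : ℝ) * (q (i + 1) x π * (1 - (1 - s / k) ^ (i + 1))) -
        ((i + 1 : ℕ) : ℝ) * q (i + 1) x π * ((1 - Real.exp (-((u i).1 * s))) / (u i).1) =
        ((i + 1 : ℕ) : ℝ) * q (i + 1) x π * (k * (1 - (1 - s / k) ^ (i + 1)) / ((i + 1 : ℕ) : ℝ) -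
          (1 - Real.exp (-((u i).1 * s))) / (u i).1) := by
      field_simp
    rw [h3, abs_mul, abs_of_nonneg (by positivity)]
    gcongr
  have hsub := hsumq.sub hsumκ
  have hmaj := hwtsum.mul_right (s ^ 2 / k)
  have hw1r : (∑' i, w i π).toReal ≤ 1 := ENNReal.toReal_le_of_le_ofReal zero_le_one (by simpa using hw1 π)
  have hle : (∑' i, w i π).toReal * (s ^ 2 / k) ≤ s ^ 2 / k :=
    mul_le_of_le_one_left (by positivity) hw1r
  rw [abs_le]
  constructor
  · have := hasSum_le (fun i => (abs_le.1 (hbound i)).1) hmaj.neg hsub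
    change _ ≤ (k : ℝ) * (1 - genFun q x π (1 - s / k)) - ∫ t, laplaceQuotient s t ∂(κ π)
    linarith
  · have := hasSum_le (fun i => (abs_le.1 (hbound i)).2) hsub hmaj
    exact this.trans hle

namespace SubcriticalApprox

variable {G : Kernel E (ProbabilityMeasure E)}
  {q : ℕ → ℕ → E → ProbabilityMeasure E → ℝ} {ζ : E → (E → ℝ) → ℝ}

theorem tendsto_apply (h : SubcriticalApprox G q ζ) (x : E) {f : E → ℝ} (hf : f ∈ BPlus E) :
    Tendsto (fun k => particleZeta G (q k) k x f) atTop (𝓝 (ζ x f)) := by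
  obtain ⟨a, ha, hfa⟩ := exists_mem_BPlusLE hf
  exact (h.tendsto a ha).tendsto_at (show (x, f) ∈ univ ×ˢ BPlusLE E a from ⟨mem_univ _, hfa⟩)

theorem measurable_limit [IsMarkovKernel G] (h : SubcriticalApprox G q ζ) {f : E → ℝ} (hf : f ∈ BPlus E) :
    Measurable fun x => ζ x f := by
  obtain ⟨a, ha, hfa⟩ := exists_mem_BPlusLE hf
  obtain ⟨n, hn⟩ := exists_nat_ge a
  -- The shift leaves only indices `k ≥ 1` with `k ≥ a`, for which the generating functions are
  -- evaluated inside `[0, 1]`.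
  refine measurable_of_tendsto_metrizable
    (f := fun k x => particleZeta G (q (k + (n + 1))) (k + (n + 1) : ℕ) x f) (fun k => ?_)
    (tendsto_pi_nhds.2 fun x => (tendsto_add_atTop_iff_nat (n + 1)).2 (h.tendsto_apply x hf))
  refine measurable_particleZeta G (h.law _ (by omega)) (by omega) hfa (hn.trans ?_)
  exact_mod_cast (by omega : n ≤ k + (n + 1))

/-- For `f ≤ a` the particle form differs from the integral of the Laplace quotient by at most `a² /
(k + 1)`, uniformly in `π`, so both have the limit `ζ x f`. Compactness relative to the fixed
measure `G x` then produces `η`, with no claim on its dependence on `x`. -/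
theorem exists_joint [IsMarkovKernel G] (h : SubcriticalApprox G q ζ) (x : E) :
    ∃ η : Kernel (ProbabilityMeasure E) I, IsMarkovKernel η ∧ ∀ f ∈ BPlus E,
      ∫ π, ∫ t, laplaceQuotient (∫ y, f y ∂(π : Measure E)) t ∂(η π) ∂(G x) = ζ x f := by
  choose κ hκ hκb using fun k : ℕ => exists_kernel_sizeBiased (h.law (k + 1) (by omega)) x
    (h.mean_le_one (k + 1) (by omega) x) (Nat.succ_pos k)
  have hconv : ∀ f ∈ BPlus E, Tendsto (fun k => ∫ π, ∫ t,
      laplaceQuotient (∫ y, f y ∂(π : Measure E)) t ∂(κ k π) ∂(G x)) atTop (𝓝 (ζ x f)) := by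
    intro f hf
    obtain ⟨a, ha, hfa⟩ := exists_mem_BPlusLE hf
    have hsm := measurable_integral_probabilityMeasure hf
    have hlim := (tendsto_add_atTop_iff_nat 1).2 (h.tendsto_apply x hf)
    refine hlim.congr_dist ?_
    have h0 : Tendsto (fun k : ℕ => a ^ 2 * (1 / ((k : ℝ) + 1))) atTop (𝓝 0) := by
      simpa using tendsto_one_div_add_atTop_nhds_zero_nat.const_mul (a ^ 2)
    refine squeeze_zero' (Eventually.of_forall fun _ => dist_nonneg) ?_ h0
    obtain ⟨n, hn⟩ := exists_nat_ge a
    filter_upwards [eventually_ge_atTop n] with k hk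
    have hk' : (0 : ℝ) < ((k + 1 : ℕ) : ℝ) := by positivity
    have hak : a ≤ ((k + 1 : ℕ) : ℝ) := hn.trans (by exact_mod_cast (by omega : n ≤ k + 1))
    have hlaw := h.law (k + 1) (by omega)
    have hi1 : Integrable (fun π : ProbabilityMeasure E => ((k + 1 : ℕ) : ℝ) *
        (1 - genFun (q (k + 1)) x π (1 - (∫ y, f y ∂(π : Measure E)) / ((k + 1 : ℕ) : ℝ)))) (G x) := by
      refine Integrable.of_bound ((measurable_particle_integrand hlaw (Nat.succ_pos k) hfa hak).comp
        measurable_prodMk_left).aestronglyMeasurable ((k + 1 : ℕ) : ℝ) (Eventually.of_forall fun π => ?_)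
      have h1 := integral_mem_Icc hfa π
      have h2 := hlaw.genFun_mem_Icc x π (one_sub_div_mem_Icc hk' h1.1 (h1.2.trans hak))
      rw [Real.norm_eq_abs, abs_of_nonneg (mul_nonneg hk'.le (by linarith [h2.2]))]
      exact mul_le_of_le_one_right hk'.le (by linarith [h2.1])
    have hi2 : Integrable (fun π : ProbabilityMeasure E =>
        ∫ t, laplaceQuotient (∫ y, f y ∂(π : Measure E)) t ∂(κ k π)) (G x) := by
      have hm : Measurable fun p : ProbabilityMeasure E × I =>
          laplaceQuotient (∫ y, f y ∂(p.1 : Measure E)) p.2 :=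
        measurable_laplaceQuotient.comp ((hsm.comp measurable_fst).prodMk measurable_snd)
      refine Integrable.of_bound
        (hm.stronglyMeasurable.integral_kernel_prod_right (κ := κ k)
          (f := fun (π : ProbabilityMeasure E) t =>
            laplaceQuotient (∫ y, f y ∂(π : Measure E)) t)).aestronglyMeasurable a
        (Eventually.of_forall fun π => ?_)
      have := norm_integral_le_of_norm_le_const (μ := κ k π) (C := a)
        (f := laplaceQuotient (∫ y, f y ∂(π : Measure E))) (Eventually.of_forall fun t => by
          have h1 := integral_mem_Icc hfa π
          have h2 := laplaceQuotient_mem_Icc h1.1 t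
          rw [Real.norm_eq_abs, abs_of_nonneg h2.1]
          exact h2.2.trans h1.2)
      simpa using this
    rw [Real.dist_eq, particleZeta, ← integral_sub hi1 hi2]
    have := norm_integral_le_of_norm_le_const (μ := G x) (C := a ^ 2 * (1 / ((k : ℝ) + 1)))
      (f := fun π : ProbabilityMeasure E => ((k + 1 : ℕ) : ℝ) *
        (1 - genFun (q (k + 1)) x π (1 - (∫ y, f y ∂(π : Measure E)) / ((k + 1 : ℕ) : ℝ))) -
        ∫ t, laplaceQuotient (∫ y, f y ∂(π : Measure E)) t ∂(κ k π))
      (Eventually.of_forall fun π => by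
        have h1 := integral_mem_Icc hfa π
        refine (hκb k π _ h1.1 (h1.2.trans hak)).trans ?_
        rw [mul_one_div]
        push_cast
        gcongr
        · exact h1.1
        · exact h1.2)
    simpa using this
  obtain ⟨η, hη, hηζ⟩ := exists_kernel_of_tendsto (G x) κ (ι := BPlus E)
    (fun f π t => laplaceQuotient (∫ y, f.1 y ∂(π : Measure E)) t)
    (fun f => measurable_laplaceQuotient.comp
      (((measurable_integral_probabilityMeasure f.2).comp measurable_fst).prodMk measurable_snd))
    (fun f π => continuous_laplaceQuotient (integral_nonneg f.2.2.1))
    (fun f => by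
      obtain ⟨a, ha, hfa⟩ := exists_mem_BPlusLE f.2
      refine ⟨a, fun π t => ?_⟩
      have h1 := integral_mem_Icc hfa π
      have h2 := laplaceQuotient_mem_Icc h1.1 t
      rw [abs_of_nonneg h2.1]
      exact h2.2.trans h1.2)
    (fun f => ζ x f.1) fun f => hconv f.1 f.2
  exact ⟨η, hη, fun f hf => hηζ ⟨f, hf⟩⟩

/-- The pointwise choice of `lam x` and `Γ x` carries no measurability; it is regained from that of
`ζ(·, f)`, a limit of measurable particle forms. -/
theorem exists_measureRep [IsMarkovKernel G] (h : SubcriticalApprox G q ζ) :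
    ∃ (lam : E → Measure E) (Γ : E → Measure (NonzeroFiniteMeasure E)), MeasureRep lam Γ ζ := by
  have hx : ∀ x, ∃ (lam : Measure E) (Γ : Measure (NonzeroFiniteMeasure E)),
      lam univ + ∫⁻ ν, (ν.1.mass : ℝ≥0∞) ∂Γ ≤ 1 ∧ ∀ f ∈ BPlus E, ζ x f = (∫ y, f y ∂lam) +
          ∫ ν, (1 - Real.exp (-∫ y, f y ∂(ν.1 : Measure E))) ∂Γ := by
    intro x
    obtain ⟨η, hη, hηζ⟩ := h.exists_joint x
    obtain ⟨lam, Γ, hmass, hrep⟩ := exists_measures_of_joint (G x ⊗ₘ η)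
    refine ⟨lam, Γ, hmass, fun f hf => ?_⟩
    rw [← hrep f hf, ← hηζ f hf, Measure.integral_compProd]
    obtain ⟨a, ha, hfa⟩ := exists_mem_BPlusLE hf
    refine Integrable.of_bound (measurable_laplaceQuotient.comp
      (((measurable_integral_probabilityMeasure hf).comp measurable_fst).prodMk
        measurable_snd)).aestronglyMeasurable a (Eventually.of_forall fun p => ?_)
    have h1 := integral_mem_Icc hfa p.1
    have h2 := laplaceQuotient_mem_Icc h1.1 p.2
    rw [Real.norm_eq_abs, abs_of_nonneg h2.1]
    exact h2.2.trans h1.2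
  choose lam Γ hmass hrep using hx
  exact ⟨lam, Γ, MeasureRep.of_measurable hmass hrep fun f hf => h.measurable_limit hf⟩

end SubcriticalApprox

end NonlocalBranching
-- Poissonisation: exact particle forms for mixtures.
namespace NonlocalBranching

open unitInterval

section Poisson

/-- The Poisson weight of `i + 1`. -/
noncomputable def poissonWeight (y : ℝ) (i : ℕ) : ℝ :=
  Real.exp (-y) * (y ^ (i + 1) / (i + 1).factorial)

theorem poissonWeight_nonneg {y : ℝ} (hy : 0 ≤ y) (i : ℕ) : 0 ≤ poissonWeight y i := by
  unfold poissonWeight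
  positivity

theorem hasSum_real_exp (y : ℝ) : HasSum (fun i : ℕ => y ^ i / i.factorial) (Real.exp y) := by
  rw [Real.exp_eq_exp_ℝ]
  exact NormedSpace.expSeries_div_hasSum_exp y

theorem hasSum_mul_poissonWeight (y : ℝ) :
    HasSum (fun i : ℕ => ((i + 1 : ℕ) : ℝ) * poissonWeight y i) y := by
  have h := (hasSum_real_exp y).mul_left (Real.exp (-y) * y)
  rw [mul_right_comm, ← Real.exp_add, neg_add_cancel, Real.exp_zero, one_mul] at h
  refine h.congr_fun fun i => ?_
  rw [poissonWeight, Nat.factorial_succ]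
  have : (0 : ℝ) < ((i + 1 : ℕ) : ℝ) := by positivity
  push_cast at *
  field_simp
  ring

/-- This is `1 - E[z^N]` for `N` Poisson with mean `y`; the term `N = 0` drops out. With `y = u k`
and `z = 1 - s / k` the exponent is `u s`, free of `k`. -/
theorem hasSum_poissonWeight_mul_one_sub (y z : ℝ) :
    HasSum (fun i : ℕ => poissonWeight y i * (1 - z ^ (i + 1))) (1 - Real.exp (-(y * (1 - z)))) := by
  have h := ((hasSum_real_exp y).sub (hasSum_real_exp (y * z))).mul_left (Real.exp (-y))
  rw [mul_sub, ← Real.exp_add, ← Real.exp_add, neg_add_cancel, Real.exp_zero,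
    show -y + y * z = -(y * (1 - z)) by ring] at h
  have h2 := (hasSum_nat_add_iff' 1).2 h
  simp only [Finset.range_one, Finset.sum_singleton, pow_zero, sub_self, mul_zero, sub_zero] at h2
  refine h2.congr_fun fun i => ?_
  rw [poissonWeight, mul_pow]
  ring

end Poisson

variable {E : Type*} [MeasurableSpace E]

/-- The offspring law with the prescribed weights on `1, 2, …` and the remaining mass at `0`. -/
noncomputable def offspringOfWeights (p : ℕ → E → ProbabilityMeasure E → ℝ≥0∞) :
    ℕ → E → ProbabilityMeasure E → ℝ
  | 0, x, π => 1 - (∑' i, p i x π).toReal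
  | i + 1, x, π => (p i x π).toReal

section Weights

variable {p : ℕ → E → ProbabilityMeasure E → ℝ≥0∞}
  (hp1 : ∀ x π, ∑' i, ((i + 1 : ℕ) : ℝ≥0∞) * p i x π ≤ 1)
include hp1

theorem tsum_weights_le_one (x : E) (π : ProbabilityMeasure E) : ∑' i, p i x π ≤ 1 := by
  refine (ENNReal.tsum_le_tsum fun i => ?_).trans (hp1 x π)
  exact le_mul_of_one_le_left' (by exact_mod_cast Nat.succ_pos i)

theorem weights_ne_top (i : ℕ) (x : E) (π : ProbabilityMeasure E) : p i x π ≠ ∞ :=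
  ENNReal.ne_top_of_tsum_ne_top
    (ne_top_of_le_ne_top ENNReal.one_ne_top (tsum_weights_le_one hp1 x π)) i

theorem offspringOfWeights_nonneg (i : ℕ) (x : E) (π : ProbabilityMeasure E) :
    0 ≤ offspringOfWeights p i x π := by
  cases i with
  | zero =>
    have := ENNReal.toReal_mono ENNReal.one_ne_top (tsum_weights_le_one hp1 x π)
    rw [ENNReal.toReal_one] at this
    exact sub_nonneg.2 this
  | succ i => exact ENNReal.toReal_nonneg

theorem hasSum_offspringOfWeights (x : E) (π : ProbabilityMeasure E) :
    HasSum (fun i => offspringOfWeights p i x π) 1 := by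
  have hne : ∑' i, p i x π ≠ ∞ :=
    ne_top_of_le_ne_top ENNReal.one_ne_top (tsum_weights_le_one hp1 x π)
  have h := ENNReal.hasSum_toReal hne
  rw [← ENNReal.tsum_toReal_eq (ENNReal.ne_top_of_tsum_ne_top hne)] at h
  refine (hasSum_nat_add_iff' 1).1 ?_
  simpa [offspringOfWeights] using h

theorem offspringMean_offspringOfWeights_le (x : E) (π : ProbabilityMeasure E) :
    offspringMean (offspringOfWeights p) x π ≤ 1 := by
  rw [offspringMean, tsum_eq_zero_add' ENNReal.summable, Nat.cast_zero, zero_mul, zero_add]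
  refine le_trans (le_of_eq (tsum_congr fun i => ?_)) (hp1 x π)
  rw [offspringOfWeights, ENNReal.ofReal_toReal (weights_ne_top hp1 i x π)]

theorem one_sub_genFun_offspringOfWeights (x : E) (π : ProbabilityMeasure E) {z : ℝ}
    (hz : z ∈ Icc (0 : ℝ) 1) : 1 - genFun (offspringOfWeights p) x π z =
      (∑' i, p i x π * ENNReal.ofReal (1 - z ^ (i + 1))).toReal := by
  have hle : ∀ i : ℕ, ENNReal.ofReal (1 - z ^ (i + 1)) ≤ 1 := fun i => by
    rw [← ENNReal.ofReal_one]
    exact ENNReal.ofReal_le_ofReal (by linarith [pow_nonneg hz.1 (i + 1)])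
  have h1 := hasSum_offspringOfWeights hp1 x π
  have hs : Summable fun i => offspringOfWeights p i x π * z ^ i :=
    h1.summable.of_nonneg_of_le
      (fun i => mul_nonneg (offspringOfWeights_nonneg hp1 i x π) (pow_nonneg hz.1 _))
      fun i => mul_le_of_le_one_right (offspringOfWeights_nonneg hp1 i x π)
        (pow_le_one₀ hz.1 hz.2)
  have h2 := (hasSum_nat_add_iff' 1).2 (h1.sub hs.hasSum)
  simp only [Finset.range_one, Finset.sum_singleton, pow_zero, mul_one, sub_self, sub_zero] at h2
  rw [genFun, ← h2.tsum_eq, ENNReal.tsum_toReal_eq fun i =>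
    ENNReal.mul_ne_top (weights_ne_top hp1 i x π) ENNReal.ofReal_ne_top]
  refine tsum_congr fun i => ?_
  rw [ENNReal.toReal_mul, ENNReal.toReal_ofReal (sub_nonneg.2 (pow_le_one₀ hz.1 hz.2)),
    offspringOfWeights]
  ring

theorem isOffspringLaw_offspringOfWeights
    (hpm : ∀ i, Measurable fun r : E × ProbabilityMeasure E => p i r.1 r.2) :
    IsOffspringLaw (offspringOfWeights p) where
  nonneg := offspringOfWeights_nonneg hp1
  hasSum_one := hasSum_offspringOfWeights hp1
  measurable_genFun := by
    have h : Measurable fun r : E × ProbabilityMeasure E × Icc (0 : ℝ) 1 =>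
        1 - (∑' i, p i r.1 r.2.1 * ENNReal.ofReal (1 - (r.2.2 : ℝ) ^ (i + 1))).toReal := by
      refine measurable_const.sub (Measurable.ennreal_toReal (Measurable.tsum fun i => ?_))
      refine Measurable.mul ((hpm i).comp
        (measurable_fst.prodMk (measurable_fst.comp measurable_snd))) ?_
      fun_prop
    convert h using 2 with r
    rw [← one_sub_genFun_offspringOfWeights hp1 r.1 r.2.1 r.2.2.2]
    ring
  mean_bounded := ⟨1, fun x π => by simpa using offspringMean_offspringOfWeights_le hp1 x π⟩

end Weights

/-- The density `u` is finite and strictly positive on `(0, ∞)`, so it can be divided out again. -/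
theorem measurable_of_measurable_withDensity {α : Type*} [MeasurableSpace α]
    {n : α → Measure PosReal}
    (hn : Measurable fun a => (n a).withDensity fun u => ENNReal.ofReal u.1) : Measurable n := by
  have hu : Measurable fun u : PosReal => ENNReal.ofReal u.1 := by fun_prop
  have : n = fun a => ((n a).withDensity fun u => ENNReal.ofReal u.1).withDensity
      fun u => (ENNReal.ofReal u.1)⁻¹ := by
    funext a
    exact (withDensity_inv_same hu (Eventually.of_forall fun u => by simpa using u.2)
      (Eventually.of_forall fun u => ENNReal.ofReal_ne_top)).symm
  rw [this]
  exact measurable_withDensity hn hu.inv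

/-- Poissonisation of the pair `(d, n)`: the weights of `1, 2, …` in the law of the number of particles of
mass `1 / k`. -/
noncomputable def poissonisedWeight (d : E × ProbabilityMeasure E → ℝ)
    (n : E × ProbabilityMeasure E → Measure PosReal) (k i : ℕ) (x : E)
    (π : ProbabilityMeasure E) : ℝ≥0∞ :=
  (if i = 0 then ENNReal.ofReal (d (x, π)) else 0) +
    (k : ℝ≥0∞)⁻¹ * ∫⁻ u, ENNReal.ofReal (poissonWeight (u.1 * k) i) ∂(n (x, π))

@[fun_prop]
theorem measurable_poissonWeight (i : ℕ) : Measurable fun y => poissonWeight y i := by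
  unfold poissonWeight
  fun_prop

namespace MixtureRep

variable {G : Kernel E (ProbabilityMeasure E)} {d : E × ProbabilityMeasure E → ℝ}
  {n : E × ProbabilityMeasure E → Measure PosReal} {ζ : E → (E → ℝ) → ℝ}

theorem measurable_n (h : MixtureRep G d n ζ) : Measurable n :=
  measurable_of_measurable_withDensity h.kernel_n.1

theorem measurable_poissonisedWeight (h : MixtureRep G d n ζ) (k i : ℕ) :
    Measurable fun r : E × ProbabilityMeasure E => poissonisedWeight d n k i r.1 r.2 := by
  unfold poissonisedWeight
  refine Measurable.add ?_ (measurable_const.mul ?_)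
  · split_ifs
    · exact h.d_measurable.ennreal_ofReal
    · exact measurable_const
  · exact (Measure.measurable_lintegral (by fun_prop)).comp h.measurable_n

/-- Taking `c i = i + 1` yields the offspring mean, and `c i = 1 - z^(i + 1)` yields one minus the
generating function. -/
theorem tsum_poissonisedWeight_mul (k : ℕ) (c : ℕ → ℝ≥0∞) (x : E) (π : ProbabilityMeasure E) :
    ∑' i, poissonisedWeight d n k i x π * c i = ENNReal.ofReal (d (x, π)) * c 0 +
      (k : ℝ≥0∞)⁻¹ * ∫⁻ u, ∑' i, ENNReal.ofReal (poissonWeight (u.1 * k) i) * c i ∂(n (x, π)) := by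
  simp only [poissonisedWeight, add_mul]
  rw [ENNReal.tsum_add, tsum_eq_single 0 fun i hi => by simp [hi],
    lintegral_tsum fun i => by fun_prop, ← ENNReal.tsum_mul_left]
  simp only [if_true]
  congr 2
  funext i
  rw [mul_assoc, lintegral_mul_const _ (by fun_prop)]

/-- A Poisson(`u k`) number has mean `u k`, and the factor `1 / k` in the weights turns this into
`u`: the offspring mean is exactly `d + ∫ u n(du)`. -/
theorem tsum_mul_poissonisedWeight_le_one (h : MixtureRep G d n ζ) {k : ℕ} (hk : 0 < k) (x : E)
    (π : ProbabilityMeasure E) :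
    ∑' i, ((i + 1 : ℕ) : ℝ≥0∞) * poissonisedWeight d n k i x π ≤ 1 := by
  have hk0 : (k : ℝ≥0∞) ≠ 0 := by exact_mod_cast hk.ne'
  simp_rw [mul_comm ((_ : ℕ) : ℝ≥0∞)]
  rw [tsum_poissonisedWeight_mul]
  refine le_trans (le_of_eq ?_) (h.mass_le_one (x, π))
  have hsum : ∀ u : PosReal, ∑' i, ENNReal.ofReal (poissonWeight (u.1 * k) i) * ((i + 1 : ℕ) : ℝ≥0∞) =
      (k : ℝ≥0∞) * ENNReal.ofReal u.1 := fun u => by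
    have hy : 0 ≤ u.1 * k := mul_nonneg u.2.le k.cast_nonneg
    have hs := hasSum_mul_poissonWeight (u.1 * k)
    calc _ = ∑' i : ℕ, ENNReal.ofReal (((i + 1 : ℕ) : ℝ) * poissonWeight (u.1 * k) i) :=
          tsum_congr fun i => by
            rw [ENNReal.ofReal_mul (by positivity), ENNReal.ofReal_natCast, mul_comm]
      _ = _ := by
          rw [← ENNReal.ofReal_tsum_of_nonneg
            (fun i => mul_nonneg (by positivity) (poissonWeight_nonneg hy i)) hs.summable,
            hs.tsum_eq, ENNReal.ofReal_mul u.2.le, ENNReal.ofReal_natCast, mul_comm]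
  simp_rw [hsum]
  rw [lintegral_const_mul _ (by fun_prop), ← mul_assoc,
    ENNReal.inv_mul_cancel hk0 (ENNReal.natCast_ne_top k)]
  simp

theorem lintegral_ne_top (h : MixtureRep G d n ζ) (r : E × ProbabilityMeasure E) :
    ∫⁻ u, ENNReal.ofReal u.1 ∂(n r) ≠ ∞ :=
  ne_top_of_le_ne_top ENNReal.one_ne_top (le_add_self.trans (h.mass_le_one r))

/-- An identity for every `k ≥ s`, not an approximation: the single-particle term gives `d s / k`,
the Poisson terms give `1 / k` times the jump integral, and multiplication by `k` clears both
factors. -/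
theorem particle_eq (h : MixtureRep G d n ζ) {k : ℕ} (hk : 0 < k) (x : E)
    (π : ProbabilityMeasure E) {s : ℝ} (hs : 0 ≤ s) (hsk : s ≤ k) :
    (k : ℝ) * (1 - genFun (offspringOfWeights (poissonisedWeight d n k)) x π (1 - s / k)) =
      d (x, π) * s + ∫ u, (1 - Real.exp (-(u.1 * s))) ∂(n (x, π)) := by
  have hk' : (0 : ℝ) < k := by exact_mod_cast hk
  have hz := one_sub_div_mem_Icc hk' hs hsk
  rw [one_sub_genFun_offspringOfWeights (h.tsum_mul_poissonisedWeight_le_one hk) x π hz,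
    tsum_poissonisedWeight_mul]
  have hpos : ∀ u : PosReal, 0 ≤ 1 - Real.exp (-(u.1 * s)) := fun u =>
    (one_sub_exp_neg_mem_Icc (mul_nonneg u.2.le hs)).1
  have hsum : ∀ u : PosReal, ∑' i, ENNReal.ofReal (poissonWeight (u.1 * k) i) *
      ENNReal.ofReal (1 - (1 - s / k) ^ (i + 1)) = ENNReal.ofReal (1 - Real.exp (-(u.1 * s))) :=
    fun u => by
      have hy : 0 ≤ u.1 * k := mul_nonneg u.2.le k.cast_nonneg
      have hs := hasSum_poissonWeight_mul_one_sub (u.1 * k) (1 - s / k)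
      rw [show u.1 * k * (1 - (1 - s / k)) = u.1 * s by field_simp; ring] at hs
      simp_rw [← ENNReal.ofReal_mul (poissonWeight_nonneg hy _)]
      rw [← ENNReal.ofReal_tsum_of_nonneg (fun i => mul_nonneg (poissonWeight_nonneg hy i)
        (sub_nonneg.2 (pow_le_one₀ hz.1 hz.2))) hs.summable, hs.tsum_eq]
  simp_rw [hsum]
  have hfin : ∫⁻ u : PosReal, ENNReal.ofReal (1 - Real.exp (-(u.1 * s))) ∂(n (x, π)) ≠ ∞ := by
    refine ne_top_of_le_ne_top (ENNReal.mul_ne_top ENNReal.ofReal_ne_top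
      (h.lintegral_ne_top (x, π))) ((lintegral_mono fun u => ?_).trans_eq
        (lintegral_const_mul (ENNReal.ofReal s) (by fun_prop)))
    rw [← ENNReal.ofReal_mul hs, mul_comm s]
    exact ENNReal.ofReal_le_ofReal (one_sub_exp_neg_mem_Icc (mul_nonneg u.2.le hs)).2
  have hsk0 : (0 : ℝ) ≤ s / k := by positivity
  rw [integral_eq_lintegral_of_nonneg_ae (Eventually.of_forall hpos)
      (by fun_prop : Measurable fun u : PosReal => 1 - Real.exp (-(u.1 * s))).aestronglyMeasurable,
    ENNReal.toReal_add (ENNReal.mul_ne_top ENNReal.ofReal_ne_top ENNReal.ofReal_ne_top)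
      (ENNReal.mul_ne_top (ENNReal.inv_ne_top.2 (by exact_mod_cast hk.ne')) hfin),
    ENNReal.toReal_mul, ENNReal.toReal_mul, ENNReal.toReal_ofReal (h.d_nonneg _),
    ENNReal.toReal_ofReal (by simpa using hsk0), ENNReal.toReal_inv, ENNReal.toReal_natCast]
  simp only [zero_add, pow_one, sub_sub_cancel]
  field_simp

theorem exists_subcriticalApprox (h : MixtureRep G d n ζ) :
    ∃ q : ℕ → ℕ → E → ProbabilityMeasure E → ℝ, SubcriticalApprox G q ζ := by
  refine ⟨fun k => offspringOfWeights (poissonisedWeight d n k), fun k hk =>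
    isOffspringLaw_offspringOfWeights (h.tsum_mul_poissonisedWeight_le_one hk)
      (h.measurable_poissonisedWeight k), fun k hk =>
    offspringMean_offspringOfWeights_le (h.tsum_mul_poissonisedWeight_le_one hk),
    fun a ha => ?_⟩
  rw [Metric.tendstoUniformlyOn_iff]
  intro ε hε
  obtain ⟨m, hm⟩ := exists_nat_ge a
  filter_upwards [eventually_ge_atTop (m + 1)] with k hk
  rintro ⟨x, f⟩ ⟨-, hf⟩
  have hak : a ≤ k := hm.trans (by exact_mod_cast (by omega : m ≤ k))
  rw [h.rep x f (mem_BPlus_of_mem_BPlusLE hf), particleZeta]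
  simp_rw [fun π : ProbabilityMeasure E => h.particle_eq (by omega : 0 < k) x π
    (integral_mem_Icc hf π).1 ((integral_mem_Icc hf π).2.trans hak)]
  rwa [dist_self]

end MixtureRep

end NonlocalBranching
-- From (B) to the mixture form: polar coordinates and disintegration.
namespace NonlocalBranching

open unitInterval

theorem IsLusin.countablyGenerated {E : Type*} [TopologicalSpace E] [MeasurableSpace E]
    [BorelSpace E] (hE : IsLusin E) : MeasurableSpace.CountablyGenerated E := by
  obtain ⟨K, _, _, e, he, -⟩ := hE
  have : SecondCountableTopology E := he.secondCountableTopology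
  infer_instance

variable {E : Type*} [MeasurableSpace E]

/-- Needed to disintegrate jointly measurably in `(x, π)`. A countable generating algebra is a
π-system, so the evaluations on it already generate the σ-algebra of `M₀(E)`, which is thus pulled
back from a countable product. -/
instance countablyGenerated_probabilityMeasure [MeasurableSpace.CountablyGenerated E] :
    MeasurableSpace.CountablyGenerated (ProbabilityMeasure E) := by
  set S : Set (Set E) := generateSetAlgebra (MeasurableSpace.countableGeneratingSet E) with hS
  have hcount : Countable S :=
    (countable_generateSetAlgebra MeasurableSpace.countable_countableGeneratingSet).to_subtype
  have hgen : ‹MeasurableSpace E› = MeasurableSpace.generateFrom S := by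
    rw [hS, generateFrom_generateSetAlgebra_eq, MeasurableSpace.generateFrom_countableGeneratingSet]
  have hpi : IsPiSystem S := fun s hs t ht _ => isSetAlgebra_generateSetAlgebra.inter_mem hs ht
  set F : ProbabilityMeasure E → S → ℝ≥0∞ := fun π s => (π : Measure E) s.1 with hF
  have heq : (inferInstance : MeasurableSpace (ProbabilityMeasure E)) =
      MeasurableSpace.comap F inferInstance := by
    refine le_antisymm ?_ ?_
    · refine Measurable.comap_le ?_
      refine @Measurable.measure_of_isPiSystem_of_isProbabilityMeasure (ProbabilityMeasure E) E
        (MeasurableSpace.comap F inferInstance) _ _ (fun π => π.2) S hgen hpi ?_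
      intro s hs
      exact (measurable_pi_apply (⟨s, hs⟩ : S)).comp (comap_measurable F)
    · refine Measurable.comap_le (measurable_pi_iff.2 fun s => ?_)
      refine (Measure.measurable_coe ?_).comp measurable_subtype_coe
      rw [hgen]
      exact MeasurableSpace.measurableSet_generateFrom s.2
  have hB : MeasurableSpace.CountablyGenerated (S → ℝ≥0∞) := inferInstance
  have h := MeasurableSpace.CountablyGenerated.comap (β := S → ℝ≥0∞) F
  rw [← heq] at h
  exact h

theorem measurable_normalize [Nonempty E] :
    Measurable (FiniteMeasure.normalize : FiniteMeasure E → ProbabilityMeasure E) := by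
  have hcoe : ∀ s : Set E, MeasurableSet s → Measurable fun ν : FiniteMeasure E => (ν : Measure E) s :=
    fun s hs => (Measure.measurable_coe hs).comp measurable_subtype_coe
  refine Measurable.subtype_mk (f := fun ν : FiniteMeasure E => (ν.normalize : Measure E)) ?_
  refine Measure.measurable_of_measurable_coe _ fun s hs => ?_
  -- At mass zero `normalize` takes a fixed default value, so a split by mass suffices.
  have heq : (fun ν : FiniteMeasure E => (ν.normalize : Measure E) s) =
      fun ν : FiniteMeasure E =>
      if (ν.mass : ℝ≥0∞) = 0 then ((0 : FiniteMeasure E).normalize : Measure E) s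
      else (ν.mass : ℝ≥0∞)⁻¹ * (ν : Measure E) s := by
    funext ν
    split_ifs with h
    · rw [ν.mass_zero_iff.1 (by exact_mod_cast h)]
    · have h0 : ν.mass ≠ 0 := by exact_mod_cast h
      rw [ν.toMeasure_normalize_eq_of_nonzero (ν.mass_nonzero_iff.1 h0), Measure.smul_apply,
        ← ENNReal.coe_inv h0]
      rfl
  rw [heq]
  exact Measurable.ite (measurable_mass (measurableSet_singleton 0)) measurable_const
    (measurable_mass.inv.mul (hcoe s hs))

/-- Also valid at the zero measure, whatever its normalisation, since both sides vanish there; `lam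
x` may be zero. -/
theorem mass_mul_integral_normalize [Nonempty E] (ν : FiniteMeasure E) (f : E → ℝ) :
    (ν.mass : ℝ) * ∫ y, f y ∂(ν.normalize : Measure E) = ∫ y, f y ∂(ν : Measure E) := by
  have h : (ν : Measure E) = ν.mass • (ν.normalize : Measure E) :=
    congrArg FiniteMeasure.toMeasure ν.self_eq_mass_smul_normalize
  conv_rhs => rw [h]
  rw [integral_smul_nnreal_measure]
  rfl

/-- The mass of a nonzero finite measure. -/
noncomputable def massPos (ν : NonzeroFiniteMeasure E) : PosReal := ⟨ν.1.mass, ν.mass_pos⟩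

theorem measurable_massPos : Measurable (massPos : NonzeroFiniteMeasure E → PosReal) :=
  Measurable.subtype_mk (measurable_nonzero_mass.ennreal_toReal)

/-- The polar coordinates `(ν / ν(1), ν(1))`. -/
noncomputable def polar [Nonempty E] (ν : NonzeroFiniteMeasure E) : ProbabilityMeasure E × I :=
  (ν.1.normalize, toUnit (massPos ν))

theorem measurable_polar [Nonempty E] :
    Measurable (polar : NonzeroFiniteMeasure E → ProbabilityMeasure E × I) :=
  (measurable_normalize.comp measurable_subtype_coe).prodMk
    (measurable_toUnit.comp measurable_massPos)

theorem measurable_laplaceQuotient_eval {f : E → ℝ} (hf : f ∈ BPlus E) :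
    Measurable fun p : ProbabilityMeasure E × I =>
      laplaceQuotient (∫ y, f y ∂(p.1 : Measure E)) p.2 :=
  measurable_laplaceQuotient.comp
    (((measurable_integral_probabilityMeasure hf).comp measurable_fst).prodMk measurable_snd)

theorem integrable_laplaceQuotient_eval {f : E → ℝ} (hf : f ∈ BPlus E)
    (ρ : Measure (ProbabilityMeasure E × I)) [IsFiniteMeasure ρ] :
    Integrable (fun p => laplaceQuotient (∫ y, f y ∂(p.1 : Measure E)) p.2) ρ := by
  obtain ⟨a, ha, hfa⟩ := exists_mem_BPlusLE hf
  refine Integrable.of_bound (measurable_laplaceQuotient_eval hf).aestronglyMeasurable a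
    (Eventually.of_forall fun p => ?_)
  have h1 := integral_mem_Icc hfa p.1
  have h2 := laplaceQuotient_mem_Icc h1.1 p.2
  rw [Real.norm_eq_abs, abs_of_nonneg h2.1]
  exact h2.2.trans h1.2

/-- The mass of `lam x` sits at its normalisation with `u = 0`, the finite measure `ν(1) Γ(x, dν)`
is transported by polar coordinates, and the deficit is put at `u = ∞` over an arbitrary `π`, a
Dirac mass at some point of `E`. -/
theorem MeasureRep.exists_joint [Nonempty E] {lam : E → Measure E}
    {Γ : E → Measure (NonzeroFiniteMeasure E)} {ζ : E → (E → ℝ) → ℝ} (h : MeasureRep lam Γ ζ) :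
    ∃ κ : Kernel E (ProbabilityMeasure E × I), IsMarkovKernel κ ∧ ∀ x, ∀ f ∈ BPlus E,
      ζ x f = ∫ p, laplaceQuotient (∫ y, f y ∂(p.1 : Measure E)) p.2 ∂(κ x) := by
  classical
  obtain ⟨y₀⟩ := ‹Nonempty E›
  have hlamfin : ∀ x, IsFiniteMeasure (lam x) := fun x =>
    ⟨(le_self_add.trans (h.mass_le_one x)).trans_lt ENNReal.one_lt_top⟩
  have hlamm : Measurable fun x => lam x univ :=
    (Measure.measurable_coe MeasurableSet.univ).comp h.kernel_lam.1
  set K : E → Measure (NonzeroFiniteMeasure E) := fun x =>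
    (Γ x).withDensity fun ν => (ν.1.mass : ℝ≥0∞) with hK
  have hKm : Measurable K := h.kernel_Γ.1
  have hKuniv : ∀ x, K x univ = ∫⁻ ν, (ν.1.mass : ℝ≥0∞) ∂(Γ x) := fun x => by
    rw [hK, withDensity_apply _ MeasurableSet.univ, setLIntegral_univ]
  have hle : ∀ x, lam x univ + K x univ ≤ 1 := fun x => by
    rw [hKuniv]; exact h.mass_le_one x
  have hKfin : ∀ x, IsFiniteMeasure (K x) := fun x =>
    ⟨(le_add_self.trans (hle x)).trans_lt ENNReal.one_lt_top⟩
  set g : E → ProbabilityMeasure E × I := fun x =>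
    (FiniteMeasure.normalize ⟨lam x, hlamfin x⟩, 1) with hg
  have hgm : Measurable g :=
    (measurable_normalize.comp (h.kernel_lam.1.subtype_mk)).prodMk measurable_const
  set z : ProbabilityMeasure E × I := (⟨Measure.dirac y₀, inferInstance⟩, 0) with hz
  set κ : E → Measure (ProbabilityMeasure E × I) := fun x =>
    lam x univ • Measure.dirac (g x) + (K x).map polar +
      (1 - (lam x univ + K x univ)) • Measure.dirac z with hκ
  have hκp : ∀ x, IsProbabilityMeasure (κ x) := fun x => ⟨by
    simp only [hκ, Measure.add_apply, Measure.smul_apply, measure_univ, smul_eq_mul, mul_one,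
      Measure.map_apply measurable_polar MeasurableSet.univ, preimage_univ]
    exact add_tsub_cancel_of_le (hle x)⟩
  have hκm : Measurable κ := by
    refine Measure.measurable_of_measurable_coe _ fun s hs => ?_
    simp only [hκ, Measure.add_apply, Measure.smul_apply, smul_eq_mul]
    refine ((hlamm.mul ?_).add ?_).add (Measurable.mul ?_ measurable_const)
    · exact (Measure.measurable_coe hs).comp (Measure.measurable_dirac.comp hgm)
    · exact (Measure.measurable_coe hs).comp ((Measure.measurable_map _ measurable_polar).comp hKm)
    · exact measurable_const.sub
        (hlamm.add ((Measure.measurable_coe MeasurableSet.univ).comp hKm))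
  refine ⟨⟨κ, hκm⟩, ⟨hκp⟩, fun x f hf => ?_⟩
  have hF := measurable_laplaceQuotient_eval hf
  have hfin1 : IsFiniteMeasure (lam x univ • Measure.dirac (g x)) :=
    Measure.smul_finite _ (measure_ne_top _ _)
  have hfin3 : IsFiniteMeasure ((1 - (lam x univ + K x univ)) • Measure.dirac z) :=
    Measure.smul_finite _ (ne_top_of_le_ne_top ENNReal.one_ne_top tsub_le_self)
  have hint := fun ρ (hρ : IsFiniteMeasure ρ) => integrable_laplaceQuotient_eval hf ρ
  rw [h.rep x f hf]
  simp only [Kernel.coe_mk, hκ]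
  rw [integral_add_measure (hint _ inferInstance) (hint _ hfin3),
    integral_add_measure (hint _ hfin1) (hint _ inferInstance), integral_smul_measure,
    integral_smul_measure, integral_dirac' _ _ hF.stronglyMeasurable,
    integral_dirac' _ _ hF.stronglyMeasurable, laplaceQuotient_zero, smul_zero, add_zero,
    laplaceQuotient_one, integral_map measurable_polar.aemeasurable hF.aestronglyMeasurable,
    hK, integral_withDensity_eq_integral_toReal_smul measurable_nonzero_mass (by simp)]
  congr 1
  · exact (mass_mul_integral_normalize ⟨lam x, hlamfin x⟩ f).symm
  · refine integral_congr_ae (Eventually.of_forall fun ν => ?_)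
    have hm := ν.mass_pos
    simp only [polar, laplaceQuotient_toUnit, massPos, mass_mul_integral_normalize, smul_eq_mul,
      ENNReal.coe_toReal]
    field_simp

theorem measurable_restrict {α β : Type*} [MeasurableSpace α] [MeasurableSpace β]
    {μ : α → Measure β} (hμ : Measurable μ) {s : Set β} (hs : MeasurableSet s) :
    Measurable fun a => (μ a).restrict s := by
  refine Measure.measurable_of_measurable_coe _ fun t ht => ?_
  simp_rw [Measure.restrict_apply ht]
  exact (Measure.measurable_coe (ht.inter hs)).comp hμ

theorem withDensity_map_jumpPart (ρ : Measure I) :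
    ((jumpPart ρ id).map ofUnit).withDensity (fun u => ENNReal.ofReal u.1) =
      (ρ.restrict (Ioo 0 1)).map ofUnit := by
  ext s hs
  rw [withDensity_apply _ hs, setLIntegral_map hs (by fun_prop) measurable_ofUnit,
    Measure.map_apply measurable_ofUnit hs, ← withDensity_apply _ (measurable_ofUnit hs)]
  exact congrArg (fun μ : Measure I => μ (ofUnit ⁻¹' s)) (withDensity_jumpPart ρ measurable_id)

theorem lintegral_map_jumpPart (ρ : Measure I) :
    ∫⁻ u, ENNReal.ofReal u.1 ∂((jumpPart ρ id).map ofUnit) = ρ (Ioo 0 1) := by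
  rw [← setLIntegral_univ, ← withDensity_apply _ MeasurableSet.univ, withDensity_map_jumpPart,
    Measure.map_apply measurable_ofUnit MeasurableSet.univ, preimage_univ,
    Measure.restrict_apply_univ]

/-- `G` is the `M₀(E)`-marginal of the joint law, and the conditional law of `u` given `(x, π)`
supplies the rest: `d` is its mass at `u = 0`, and `n` is its restriction to `(0, ∞)` divided by
`u`. -/
theorem MeasureRep.exists_mixtureRep [MeasurableSpace.CountablyGenerated E] {lam : E → Measure E}
    {Γ : E → Measure (NonzeroFiniteMeasure E)} {ζ : E → (E → ℝ) → ℝ} (h : MeasureRep lam Γ ζ) :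
    ∃ (G : Kernel E (ProbabilityMeasure E)) (_ : IsMarkovKernel G)
      (d : E × ProbabilityMeasure E → ℝ) (n : E × ProbabilityMeasure E → Measure PosReal),
      MixtureRep G d n ζ := by
  rcases isEmpty_or_nonempty E with hE | hE
  -- Over an empty `E` there is no probability measure to normalise to, and every condition at a
  -- point of `E` is vacuous.
  · refine ⟨0, ⟨fun x => hE.elim x⟩, fun _ => 0, fun _ => 0, measurable_const, fun _ => le_rfl,
      ⟨0, fun _ => le_rfl⟩, ⟨by simp, 0, fun _ => by simp⟩,
      fun _ => by simp, fun x => hE.elim x⟩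
  obtain ⟨κ, hκ, hrep⟩ := h.exists_joint
  set c : Kernel (E × ProbabilityMeasure E) I := κ.condKernel with hc
  have hle : ∀ p, c p {1} + c p (Ioo 0 1) ≤ 1 := fun p => by
    have hdisj : Disjoint ({1} : Set I) (Ioo 0 1) :=
      Set.disjoint_left.2 fun t ht ht' => ht'.2.ne ht
    rw [← measure_union hdisj measurableSet_Ioo]
    exact prob_le_one
  have hd : ∀ p, ENNReal.ofReal (c p {1}).toReal = c p {1} := fun p =>
    ENNReal.ofReal_toReal (measure_ne_top _ _)
  refine ⟨κ.fst, inferInstance, fun p => (c p {1}).toReal, fun p => (jumpPart (c p) id).map ofUnit,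
    (c.measurable_coe (measurableSet_singleton 1)).ennreal_toReal,
    fun p => ENNReal.toReal_nonneg, ⟨1, fun p => ?_⟩, ⟨?_, 1, fun p => ?_⟩, fun p => ?_,
    fun x f hf => ?_⟩
  · exact ENNReal.toReal_le_of_le_ofReal zero_le_one (by simpa using prob_le_one)
  · simp_rw [withDensity_map_jumpPart]
    exact (Measure.measurable_map _ measurable_ofUnit).comp
      (measurable_restrict c.measurable measurableSet_Ioo)
  · rw [withDensity_apply _ MeasurableSet.univ, setLIntegral_univ, lintegral_map_jumpPart]
    simpa using prob_le_one
  · rw [lintegral_map_jumpPart, hd]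
    exact hle p
  · rw [hrep x f hf, ← integral_condKernel x (integrable_laplaceQuotient_eval hf (κ x))]
    refine integral_congr_ae (Eventually.of_forall fun π => ?_)
    have hs0 : 0 ≤ ∫ y, f y ∂(π : Measure E) := integral_nonneg hf.2.1
    have hsplit := integral_laplaceQuotient_eq (c (x, π)) measurable_id
      (measurable_const (a := ∫ y, f y ∂(π : Measure E))) (fun _ => hs0) (fun _ => le_rfl)
    simp only [id] at hsplit
    simp only
    rw [hsplit, integral_map measurable_ofUnit.aemeasurable
      (by fun_prop : Measurable fun u : PosReal =>
        1 - Real.exp (-(u.1 * ∫ y, f y ∂(π : Measure E)))).aestronglyMeasurable]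
    congr 1
    rw [setIntegral_const, smul_eq_mul]
    rfl

end NonlocalBranching

theorem lemma3p1 {E : Type*} [TopologicalSpace E] [MeasurableSpace E] [BorelSpace E]
    (hE : IsLusin E) :
    -- (i)
    (∀ (G : Kernel E (ProbabilityMeasure E)) (_ : IsMarkovKernel G)
        (q : ℕ → ℕ → E → ProbabilityMeasure E → ℝ) (ζ : E → (E → ℝ) → ℝ),
      SubcriticalApprox G q ζ →
        ∃ (lam : E → Measure E) (Γ : E → Measure (NonzeroFiniteMeasure E)),
          MeasureRep lam Γ ζ) ∧
    -- (ii)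
    (∀ ζ : E → (E → ℝ) → ℝ,
      (∃ (lam : E → Measure E) (Γ : E → Measure (NonzeroFiniteMeasure E)),
          MeasureRep lam Γ ζ) ↔
        ∃ (G : Kernel E (ProbabilityMeasure E)) (_ : IsMarkovKernel G)
          (d : E × ProbabilityMeasure E → ℝ) (n : E × ProbabilityMeasure E → Measure PosReal),
          MixtureRep G d n ζ) ∧
    -- (iii)
    (∀ (G : Kernel E (ProbabilityMeasure E)) (_ : IsMarkovKernel G)
        (d : E × ProbabilityMeasure E → ℝ) (n : E × ProbabilityMeasure E → Measure PosReal)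
        (ζ : E → (E → ℝ) → ℝ),
      MixtureRep G d n ζ →
        ∃ q : ℕ → ℕ → E → ProbabilityMeasure E → ℝ, SubcriticalApprox G q ζ) := by
  have := hE.countablyGenerated
  refine ⟨fun G _ q ζ h => h.exists_measureRep, fun ζ => ⟨?_, ?_⟩,
    fun G _ d n ζ h => h.exists_subcriticalApprox⟩
  · rintro ⟨lam, Γ, h⟩
    exact h.exists_mixtureRep
  -- A mixture is a limit of particle forms by (iii), so (i) gives its representation (B), kernel
  -- measurability included.
  · rintro ⟨G, _, d, n, h⟩
    obtain ⟨q, hq⟩ := h.exists_subcriticalApprox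
    exact hq.exists_measureRep
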